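/- Let $(K,v)$ be a valued field with value group $\Gamma$ (written additively, $v:K\to\Gamma\cup\{\infty\}$ surjective), and let $\Gamma_{\mathbb Q}$ be the divisible hull of $\Gamma$. A *pseudo-Cauchy sequence* in $K$ is a family $\underline a=(a_i)_{i\in I}$ of pairwise distinct elements of $K$, indexed by a well-ordered set $I$ with at least two elements (a last element is allowed), such that $v(a_i-a_j)<v(a_j-a_k)$ whenever $i<j<k$. Let $\mathbb S$ be the set of these sequences. Let $I^*$ be $I$ without its last element if there is one, and $I^*=I$ otherwise. For $i\in I^*$ put $\gamma_i=v(a_{i+1}-a_i)\in\Gamma$ and let $\nu_i$ be the monomial valuation on $K[x]$ $$\nu_i\Big(\sum_j c_j(x-a_i)^j\Big)=\min_j\{v(c_j)+j\gamma_i\}.$$ A polynomial $f\in K[x]$ is *fixed* by $\underline a$ if $v(f(a_i))$ is constant for all large enough $i\in I^*$. Suppose that $I^*$ has no last element. Then $\underline a$ is of *transcendental type* if it fixes every $f\in K[x]$, and of *algebraic type* otherwise. In the algebraic case let $F$ be a monic polynomial of smallest degree not fixed by $\underline a$, put $\delta^L=\{q\in\Gamma_{\mathbb Q}: q\le\nu_i(F)\text{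 for some }i\in I^*\}$, and let $\gamma=\sup\delta^L$, the cut in $\Gamma_{\mathbb Q}$ with left set $\delta^L$, where $\gamma=\infty$ means $\delta^L=\Gamma_{\mathbb Q}$. Define * $\mathbb S_{\rm rt}$: the sequences for which $I^*$ has a last element; * $\mathbb S_{\rm al}$: the sequences of transcendental type; * $\mathbb S_{\rm vt}$: the sequences of algebraic type with $\gamma\neq\infty$; * $\mathbb S_{\rm nt}$: the sequences of algebraic type with $\gamma=\infty$. Let $\mathbb V$ be the set of equivalence classes of valuations on $K[x]$ whose restriction to $K$ is equivalent to $v$; each class is represented by a valuation $\mu$ extending $v$, with values in $\Lambda\cup\{\infty\}$ for an ordered abelian group $\Lambda\supseteq\Gamma$. Define subsets of $\mathbb V$ as follows: * $\mathbb V_{\rm nt}$: $\operatorname{supp}\mu=\mu^{-1}(\infty)$ is generated by an irreducible polynomial; * $\mathbb V_{\rm vt}$: $\operatorname{supp}\mu=0$ and $\Gamma_\mu/\Gamma$ is not a torsion group; * $\mathbb V_{\rm rt}$: $\operatorname{supp}\mu=0$ and the residue field of $\mu$ on $K(x)$ is transcendental over the residue field of $v$; * $\mathbb V_{\rm al}$: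 $\operatorname{supp}\mu=0$, $\Gamma_\mu/\Gamma$ is torsion and this residue field extension is algebraic. For $\mu,\mu'$ extending $v$ write $\mu\le\mu'$ if, for every $f\in K[x]$, $\mu(f)\le\mu'(f)$ as quasi-cuts of $\Gamma_{\mathbb Q}$; that is, for all $q\in\Gamma_{\mathbb Q}$, $q\le\mu(f)$ implies $q\le\mu'(f)$, and $q\ge\mu'(f)$ implies $q\ge\mu(f)$. Let $\sup_{i\in I^*}\nu_i$ denote a valuation $\mu$ extending $v$ with $\nu_i\le\mu$ for all $i\in I^*$, with $\mu\le\mu'$ for every $\mu'$ extending $v$ such that $\nu_i\le\mu'$ for all $i\in I^*$, and with $\mu(f)=\infty$ whenever $\mu(f)$ is larger than every element of $\Gamma$ (a supremum that is not bounded by $\Gamma$ is $\infty$). Then such a supremum exists for every $\underline a\in\mathbb S$ and the suprema form exactly one class, so that $\Psi:\mathbb S\to\mathbb V$, $\Psi(\underline a)=[\sup_{i\in I^*}\nu_i]$, is well defined, and $$\Psi(\mathbb S_{\rm rt})\subseteq\mathbb V_{\rm rt},\quad \Psi(\mathbb S_{\rm al})\subseteq\mathbb V_{\rm al},\quad \Psi(\mathbb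 S_{\rm vt})\subseteq\mathbb V_{\rm vt},\quad \Psi(\mathbb S_{\rm nt})\subseteq\mathbb V_{\rm nt}.$$ -/

import Mathlib

open Polynomial

universe u₁ u₂ u₃

noncomputable section

/-! ### Pseudo-Cauchy sequences -/

/-- The set `𝕊` of pseudo-Cauchy sequences `{a_i}_{i ∈ I}` in the valued field `(K, v)`: `I` is a
well-ordered set with at least two elements (it may have a last element) and the `a_i` are pairwise
distinct elements of `K`. -/
structure PCSeq {K : Type u₁} [Field K] {Γ : Type u₂} [AddCommGroup Γ] [LinearOrder Γ]
    [IsOrderedAddMonoid Γ] (v : AddValuation K (WithTop Γ)) where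
  I : Type u₃
  [linearOrder : LinearOrder I]
  [wellFounded : WellFoundedLT I]
  [nontrivial : Nontrivial I]
  a : I → K
  injective : Function.Injective a
  lt_of_lt : ∀ i j k : I, i < j → j < k → v (a i - a j) < v (a j - a k)

attribute [instance] PCSeq.linearOrder PCSeq.wellFounded PCSeq.nontrivial

variable {K : Type u₁} [Field K] {Γ : Type u₂} [AddCommGroup Γ] [LinearOrder Γ]
  [IsOrderedAddMonoid Γ] {v : AddValuation K (WithTop Γ)}

namespace PCSeq

/-- The index set `I*`: `I` without its last element, if there is one. -/
def Istar (s : PCSeq v) : Set s.I := {i | ¬ IsMax i}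

/-- The successor `i + 1` in the well-ordered set `I`. -/
def succ (s : PCSeq v) (i : s.I) : s.I :=
  (SuccOrder.ofLinearWellFoundedLT s.I).succ i

/-- `γ_i = v (a_{i+1} - a_i)` (used for `i ∈ I*` only, where it is finite). -/
def gam (s : PCSeq v) (i : s.I) : WithTop Γ := v (s.a (s.succ i) - s.a i)

end PCSeq

/-- The monomial valuation
`v_{a,γ} (a_0 + a_1 (x - a) + ... + a_r (x - a)^r) = min_j (v (a_j) + j γ)`. The coefficients of the
`(x - a)`-expansion of `f` are the coefficients of `f (x + a)`. -/
def monomialVal (v : AddValuation K (WithTop Γ)) (a : K) (γ : WithTop Γ) (f : K[X]) : WithTop Γ :=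
  (Finset.range (f.natDegree + 1)).inf fun j => v ((taylor a f).coeff j) + j • γ

namespace PCSeq

/-- `ν_i = v_{a_i, γ_i}`, for `i ∈ I*`. -/
def nu (s : PCSeq v) (i : s.I) : K[X] → WithTop Γ := monomialVal v (s.a i) (s.gam i)

/-- `f` is fixed by the sequence: `v (f (a_i))` is ultimately constant along `I*`. -/
def Fixes (s : PCSeq v) (f : K[X]) : Prop :=
  ∃ i₀ ∈ s.Istar, ∀ i ∈ s.Istar, i₀ ≤ i → v (f.eval (s.a i)) = v (f.eval (s.a i₀))

/-- `I*` has a last element. -/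
def IstarHasMax (s : PCSeq v) : Prop := ∃ m, IsGreatest s.Istar m

def IsTranscendentalType (s : PCSeq v) : Prop := ¬ s.IstarHasMax ∧ ∀ f, s.Fixes f

def IsAlgebraicType (s : PCSeq v) : Prop := ¬ s.IstarHasMax ∧ ¬ ∀ f, s.Fixes f

/-- `F` is a monic polynomial of smallest degree among the polynomials not fixed by the sequence. -/
def IsMinNotFixed (s : PCSeq v) (F : K[X]) : Prop :=
  F.Monic ∧ ¬ s.Fixes F ∧ ∀ g : K[X], ¬ s.Fixes g → F.natDegree ≤ g.natDegree

end PCSeq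

/-! ### Quasi-cuts -/

variable (Γ) in
/-- A quasi-cut in the divisible hull `Γ_ℚ`: a pair of subsets `δ^L ≤ δ^R` covering `Γ_ℚ`. -/
@[ext]
structure QuasiCut where
  left : Set (DivisibleHull Γ)
  right : Set (DivisibleHull Γ)
  left_le_right : ∀ p ∈ left, ∀ q ∈ right, p ≤ q
  cover : left ∪ right = Set.univ

namespace QuasiCut

instance : PartialOrder (QuasiCut Γ) where
  le δ ε := δ.left ⊆ ε.left ∧ ε.right ⊆ δ.right
  le_refl _ := ⟨subset_rfl, subset_rfl⟩
  le_trans _ _ _ h₁ h₂ := ⟨h₁.1.trans h₂.1, h₂.2.trans h₁.2⟩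
  le_antisymm _ _ h₁ h₂ := QuasiCut.ext (h₁.1.antisymm h₂.1) (h₂.2.antisymm h₁.2)

/-- The largest quasi-cut `(Γ_ℚ, ∅)`. As the supremum of the subsets of `Γ_ℚ` that are not bounded
above it is identified with the value `∞`. -/
instance : OrderTop (QuasiCut Γ) where
  top := ⟨Set.univ, ∅, by simp, by simp⟩
  le_top _ := ⟨Set.subset_univ _, Set.empty_subset _⟩

/-- The quasi-cut `({q ∈ Γ_ℚ | q ≤ α}, {q ∈ Γ_ℚ | q ≥ α})` of an element `α ∈ Λ ∪ {∞}`, where `Λ` is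
an ordered group containing `Γ` through `e`; the inequality `g / n ≤ α` means `g ≤ n α`. -/
def ofElement {Λ : Type*} [AddCommGroup Λ] [LinearOrder Λ] [IsOrderedAddMonoid Λ]
    (e : Γ →+ Λ) (he : StrictMono e) (α : WithTop Λ) : QuasiCut Γ where
  left := {q | ∃ (g : Γ) (n : ℕ+), q = DivisibleHull.mk g n ∧ ((e g : Λ) : WithTop Λ) ≤ (n : ℕ) • α}
  right := {q | ∃ (g : Γ) (n : ℕ+), q = DivisibleHull.mk g n ∧ (n : ℕ) • α ≤ ((e g : Λ) : WithTop Λ)}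
  left_le_right := by
    rintro _ ⟨g, n, rfl, hg⟩ _ ⟨h, m, rfl, hh⟩
    rw [DivisibleHull.mk_le_mk, ← he.le_iff_le, map_nsmul, map_nsmul]
    have h1 := nsmul_le_nsmul_right hg (m : ℕ)
    have h2 := nsmul_le_nsmul_right hh (n : ℕ)
    rw [smul_comm] at h2
    exact_mod_cast h1.trans h2
  cover := by
    refine Set.eq_univ_of_forall fun q => ?_
    induction q with
    | mk g n => exact (le_total _ _).imp (fun h => ⟨g, n, rfl, h⟩) fun h => ⟨g, n, rfl, h⟩

end QuasiCut

/-- The cut `γ = sup δ^L` with left cut set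
`δ^L = {q ∈ Γ_ℚ | q ≤ ν_i (F) for some i ∈ I*}`. It is `⊤`, that is `∞`, iff `δ^L = Γ_ℚ`. -/
def PCSeq.cut (s : PCSeq v) (F : K[X]) : QuasiCut Γ where
  left := {q | ∃ i ∈ s.Istar,
    (q : WithTop (DivisibleHull Γ)) ≤ (s.nu i F).map (DivisibleHull.coeAddMonoidHom Γ)}
  right := {q | ∃ i ∈ s.Istar,
    (q : WithTop (DivisibleHull Γ)) ≤ (s.nu i F).map (DivisibleHull.coeAddMonoidHom Γ)}ᶜ
  left_le_right := by
    rintro p ⟨i, hi, hp⟩ q hq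
    by_contra h
    exact hq ⟨i, hi, (WithTop.coe_le_coe.2 (not_le.1 h).le).trans hp⟩
  cover := Set.union_compl_self _

/-! ### Valuations on `K[x]` extending `v` -/

/-- A valuation on `K[x]` extending `v`, with values in `Λ ∪ {∞}` for some ordered abelian group `Λ`
containing `Γ` (through `emb`). Up to equivalence these are all the valuations on `K[x]` whose
restriction to `K` is equivalent to `v`. -/
structure ExtVal (v : AddValuation K (WithTop Γ)) where
  Λ : Type u₂
  [addCommGroup : AddCommGroup Λ]
  [linearOrder : LinearOrder Λ]
  [isOrderedAddMonoid : IsOrderedAddMonoid Λ]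
  emb : Γ →+ Λ
  emb_strictMono : StrictMono emb
  val : AddValuation K[X] (WithTop Λ)
  val_C : ∀ c : K, val (C c) = (v c).map emb

attribute [instance] ExtVal.addCommGroup ExtVal.linearOrder ExtVal.isOrderedAddMonoid

namespace ExtVal

/-- Equivalence of valuations. -/
instance : Setoid (ExtVal v) where
  r μ μ' := μ.val.IsEquiv μ'.val
  iseqv := ⟨fun _ => .refl, fun h => h.symm, fun h h' => h.trans h'⟩

/-- The valuation `f ↦ v (f (0))`. -/
instance : Inhabited (ExtVal v) where
  default :=
    { Λ := Γ
      emb := AddMonoidHom.id Γ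
      emb_strictMono := strictMono_id
      val := v.comap (evalRingHom 0)
      val_C := fun c => by
        simp only [AddMonoidHom.coe_id, WithTop.map_id, id]
        change v ((C c).eval 0) = v c
        rw [eval_C] }

/-- The quasi-cut in `Γ_ℚ` of the value of `f`. -/
def cut (μ : ExtVal v) (f : K[X]) : QuasiCut Γ := .ofElement μ.emb μ.emb_strictMono (μ.val f)

/-- The value group: the subgroup of `Λ` generated by the finite values of `μ`. -/
def valueGroup (μ : ExtVal v) : AddSubgroup μ.Λ :=
  AddSubgroup.closure {l | ∃ f, μ.val f = (l : WithTop μ.Λ)}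

/-- The quotient `Γ_μ / Γ_v` is a torsion group. -/
def TorsionValueGroup (μ : ExtVal v) : Prop :=
  IsAddTorsion (μ.valueGroup ⧸ (μ.emb.range.addSubgroupOf μ.valueGroup))

theorem le_primeCompl_of_supp (μ : ExtVal v) (h : μ.val.supp = ⊥) :
    nonZeroDivisors K[X] ≤ μ.val.toValuation.supp.primeCompl := by
  intro f hf hf'
  have : f ∈ μ.val.supp := hf'
  rw [h] at this
  exact nonZeroDivisors.ne_zero hf this

/-- The extension of a valuation with trivial support to the field `K(x)`. -/
def fracVal (μ : ExtVal v) (h : μ.val.supp = ⊥) :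
    Valuation (RatFunc K) (Multiplicative (WithTop μ.Λ)ᵒᵈ) :=
  μ.val.toValuation.extendToLocalization (le_primeCompl_of_supp μ h) (RatFunc K)

instance hasExtension_fracVal (μ : ExtVal v) (h : μ.val.supp = ⊥) :
    v.toValuation.HasExtension (μ.fracVal h) where
  val_isEquiv_comap := by
    intro a b
    have key : ∀ c : K, (μ.fracVal h).comap (algebraMap K (RatFunc K)) c
        = Multiplicative.ofAdd (OrderDual.toDual ((v c).map μ.emb)) := by
      intro c
      rw [Valuation.comap_apply, IsScalarTower.algebraMap_apply K K[X] (RatFunc K), fracVal,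
        Valuation.extendToLocalization_apply_map_apply, ← μ.val_C]
      rfl
    rw [key, key]
    change v b ≤ v a ↔ (v b).map μ.emb ≤ (v a).map μ.emb
    exact (WithTop.map_le_iff _ fun {x y} => μ.emb_strictMono.le_iff_le).symm

/-- The residue field of `v`. -/
abbrev _root_.resField (v : AddValuation K (WithTop Γ)) : Type u₁ :=
  IsLocalRing.ResidueField v.toValuation.valuationSubring

/-- The residue field of a valuation with trivial support; it is an extension of that of `v`. -/
abbrev residueField (μ : ExtVal v) (h : μ.val.supp = ⊥) : Type u₁ :=
  IsLocalRing.ResidueField (μ.fracVal h).valuationSubring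

def HasNontrivialSupport (μ : ExtVal v) : Prop :=
  ∃ f : K[X], f ≠ 0 ∧ Irreducible f ∧ μ.val.supp = Ideal.span {f}

def IsValueTranscendental (μ : ExtVal v) : Prop :=
  μ.val.supp = ⊥ ∧ ¬ μ.TorsionValueGroup

def IsResidueTranscendental (μ : ExtVal v) : Prop :=
  ∃ h : μ.val.supp = ⊥, Algebra.Transcendental (resField v) (μ.residueField h)

def IsValuationAlgebraic (μ : ExtVal v) : Prop :=
  ∃ h : μ.val.supp = ⊥, μ.TorsionValueGroup ∧
    Algebra.IsAlgebraic (resField v) (μ.residueField h)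

/-- The order on valuations extending `v`: `μ (f) ≤ μ' (f)` for every `f`. As the groups `Λ` of `μ`
and `μ'` need not be the same, values are compared through their quasi-cuts in `Γ_ℚ`. -/
def Le (μ μ' : ExtVal v) : Prop := ∀ f, μ.cut f ≤ μ'.cut f

/-- `μ` is an upper bound of the family `{ν_i}_{i ∈ I*}`. -/
def IsUpperBound (μ : ExtVal v) (s : PCSeq v) : Prop :=
  ∀ i ∈ s.Istar, ∀ f, (s.nu i f).map μ.emb ≤ μ.val f

/-- `μ = sup_{i ∈ I*} ν_i`. The last condition is the convention that the quasi-cut `(Γ_ℚ, ∅)` is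
the value `∞`: if `μ (f)` is larger than all elements of `Γ`, then `μ (f) = ∞`. -/
def IsSup (μ : ExtVal v) (s : PCSeq v) : Prop :=
  μ.IsUpperBound s ∧ (∀ μ' : ExtVal v, μ'.IsUpperBound s → μ.Le μ') ∧
    ∀ f, μ.cut f = ⊤ → μ.val f = ⊤

end ExtVal

variable (v)

/-- The set `𝕍` of equivalence classes of valuations on `K[x]` extending `v`. -/
abbrev ValClass : Type (max u₁ (u₂ + 1)) := Quotient (inferInstance : Setoid (ExtVal v))

/-- `𝕍_nt`: nontrivial support. -/
def Vnt : Set (ValClass v) := {x | ∀ μ : ExtVal v, ⟦μ⟧ = x → μ.HasNontrivialSupport}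

/-- `𝕍_rt`: residue-transcendental. -/
def Vrt : Set (ValClass v) := {x | ∀ μ : ExtVal v, ⟦μ⟧ = x → μ.IsResidueTranscendental}

/-- `𝕍_vt`: value-transcendental. -/
def Vvt : Set (ValClass v) := {x | ∀ μ : ExtVal v, ⟦μ⟧ = x → μ.IsValueTranscendental}

/-- `𝕍_al`: valuation-algebraic. -/
def Val : Set (ValClass v) := {x | ∀ μ : ExtVal v, ⟦μ⟧ = x → μ.IsValuationAlgebraic}

/-- `𝕊_rt`: `I*` has a last element. -/
def Srt : Set (PCSeq.{u₁, u₂, u₃} v) := {s | s.IstarHasMax}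

/-- `𝕊_al`: transcendental type. -/
def Sal : Set (PCSeq.{u₁, u₂, u₃} v) := {s | s.IsTranscendentalType}

/-- `𝕊_vt`: algebraic type with `γ ≠ ∞`. -/
def Svt : Set (PCSeq.{u₁, u₂, u₃} v) :=
  {s | s.IsAlgebraicType ∧ ∃ F, s.IsMinNotFixed F ∧ s.cut F ≠ ⊤}

/-- `𝕊_nt`: algebraic type with `γ = ∞`. -/
def Snt : Set (PCSeq.{u₁, u₂, u₃} v) :=
  {s | s.IsAlgebraicType ∧ ∃ F, s.IsMinNotFixed F ∧ s.cut F = ⊤}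

/-- The map `Ψ : 𝕊 → 𝕍`, `Ψ (a) = [sup_{i ∈ I*} ν_i]`. -/
def Psi (s : PCSeq.{u₁, u₂, u₃} v) : ValClass v :=
  haveI : Nonempty (ValClass v) := ⟨⟦default⟧⟩
  Classical.epsilon fun x => ∃ μ : ExtVal v, μ.IsSup s ∧ x = ⟦μ⟧

end

/-! Along `I*` the values `ν_i(f)` increase with `i`. Call `f` stable if they are ultimately
constant. A supremum must give a stable `f` this ultimate value, so the theorem is about the
unstable polynomials.

Existence: germs of functions `I* → Γ` along an ultrafilter containing the final segments form a
linearly ordered group. The germ of `i ↦ ν_i(f)`, replaced by `∞` when it is not bounded by an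
element of `Γ`, is a valuation, and its quasi-cuts are the suprema of those of the `ν_i(f)`. By
antisymmetry every supremum has these cuts (`IsLim`).

Uniqueness: cuts of single values do not compare two values directly, so let `F` be unstable of
least degree. If the `ν_i(F)` are unbounded, `μ(F) = ∞` and `μ(f)` is the value of the stable
remainder `f % F`. If they are bounded, no positive multiple of `μ(F)` lies in `Γ`, and division by
`F` gives `μ(f) = g + j μ(F)` with `g` and `j` independent of `μ`; comparing two such values only
needs the cut of `μ(F)`.

Types: if `I*` has a last element `m`, then `μ` is `ν_m`, a Gauss valuation, which is
residue-transcendental. Otherwise Kaplansky's argument (`not_fixes_of_minimal`) shows that an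
unstable polynomial of least degree is not fixed, while stable ones are fixed. So in transcendental
type all polynomials are stable, and every nonzero residue of `K(x)` is obtained by evaluating
numerator and denominator at some `a_j`. In algebraic type the given polynomial is a minimal
unstable `F`; the bounded case is value-transcendental and in the unbounded case the support is
`(F)`. -/

noncomputable section

/-! ### Monomial valuations. -/

namespace monomialVal

variable {K : Type u₁} [Field K] {Γ : Type u₂} [AddCommGroup Γ] [LinearOrder Γ]
  [IsOrderedAddMonoid Γ] {v : AddValuation K (WithTop Γ)} {a : K} {γ : WithTop Γ}

theorem le_coeff (f : K[X]) (j : ℕ) :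
    monomialVal v a γ f ≤ v ((taylor a f).coeff j) + j • γ := by
  by_cases hj : j < f.natDegree + 1
  · exact Finset.inf_le (Finset.mem_range.2 hj)
  · rw [coeff_eq_zero_of_natDegree_lt (by rw [natDegree_taylor]; omega), v.map_zero, top_add]
    exact le_top

theorem le_iff {f : K[X]} {c : WithTop Γ} :
    c ≤ monomialVal v a γ f ↔ ∀ j, c ≤ v ((taylor a f).coeff j) + j • γ :=
  ⟨fun h j => h.trans (le_coeff f j), fun h => Finset.le_inf fun j _ => h j⟩

theorem exists_eq (v : AddValuation K (WithTop Γ)) (a : K) (γ : WithTop Γ) (f : K[X]) :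
    ∃ j, monomialVal v a γ f = v ((taylor a f).coeff j) + j • γ := by
  obtain ⟨j, -, hj⟩ := Finset.exists_mem_eq_inf (Finset.range (f.natDegree + 1))
    ⟨0, by simp⟩ fun j => v ((taylor a f).coeff j) + j • γ
  exact ⟨j, hj⟩

theorem exists_minimal (v : AddValuation K (WithTop Γ)) (a : K) (γ : WithTop Γ) {f : K[X]} :
    ∃ j, monomialVal v a γ f = v ((taylor a f).coeff j) + j • γ ∧
      ∀ i < j, monomialVal v a γ f < v ((taylor a f).coeff i) + i • γ := by
  classical
  exact ⟨_, Nat.find_spec (exists_eq v a γ f), fun i hi =>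
    lt_of_le_of_ne (le_coeff f i) (Nat.find_min (exists_eq v a γ f) hi)⟩

theorem map_C (c : K) : monomialVal v a γ (C c) = v c := by
  simp [monomialVal]

theorem map_zero : monomialVal v a γ 0 = ⊤ := by
  simpa using map_C (v := v) (a := a) (γ := γ) 0

theorem map_one : monomialVal v a γ 1 = 0 := by
  simpa using map_C (v := v) (a := a) (γ := γ) 1

theorem map_X_sub_C_le (b : K) : monomialVal v a γ (X - C b) ≤ γ := by
  have h := le_coeff (v := v) (a := a) (γ := γ) (X - C b) 1
  have h1 : (taylor a (X - C b)).coeff 1 = 1 := by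
    rw [map_sub, taylor_X, taylor_C]
    simp
  simpa only [h1, v.map_one, zero_add, one_nsmul] using h

theorem map_X_sub_C : monomialVal v a γ (X - C a) = γ := by
  refine le_antisymm (map_X_sub_C_le a) (le_iff.2 fun j => ?_)
  have : taylor a (X - C a) = X := by simp
  rw [this, coeff_X]
  split_ifs with h
  · subst h; simp
  · simp

theorem map_add (f g : K[X]) :
    min (monomialVal v a γ f) (monomialVal v a γ g) ≤ monomialVal v a γ (f + g) := by
  refine le_iff.2 fun j => ?_
  rw [_root_.map_add, coeff_add]
  refine le_trans (min_le_min (le_coeff f j) (le_coeff g j)) ?_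
  rw [min_add_add_right]
  gcongr
  exact v.map_add _ _

theorem eq_top_iff (hγ : γ ≠ ⊤) {f : K[X]} : monomialVal v a γ f = ⊤ ↔ f = 0 := by
  refine ⟨fun h => ?_, fun h => h ▸ map_zero⟩
  rw [← taylor_eq_zero a]
  ext j
  have h1 := le_coeff (v := v) (a := a) (γ := γ) f j
  rw [h, top_le_iff, WithTop.add_eq_top] at h1
  lift γ to Γ using hγ
  rw [← WithTop.coe_nsmul, or_iff_left WithTop.coe_ne_top, v.top_iff] at h1
  simpa using h1

/-- Gauss's lemma. If `i` and `j` are the least indices attaining the two minima, then in the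
coefficient of index `i + j` of the product every other term has an index below `i` or below `j`,
hence strictly larger value. -/
theorem map_mul (hγ : γ ≠ ⊤) (f g : K[X]) :
    monomialVal v a γ (f * g) = monomialVal v a γ f + monomialVal v a γ g := by
  by_cases hf : f = 0
  · simp [hf, map_zero]
  by_cases hg : g = 0
  · simp [hg, map_zero]
  have hf' : monomialVal v a γ f ≠ ⊤ := mt (eq_top_iff hγ).1 hf
  have hg' : monomialVal v a γ g ≠ ⊤ := mt (eq_top_iff hγ).1 hg
  have term : ∀ i j : ℕ, v ((taylor a f).coeff i * (taylor a g).coeff j) + (i + j) • γ =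
      (v ((taylor a f).coeff i) + i • γ) + (v ((taylor a g).coeff j) + j • γ) := by
    intro i j
    rw [v.map_mul, add_nsmul]
    abel
  obtain ⟨i, hi, hi'⟩ := exists_minimal v a γ (f := f)
  obtain ⟨j, hj, hj'⟩ := exists_minimal v a γ (f := g)
  apply le_antisymm
  · refine (le_coeff (f * g) (i + j)).trans ?_
    rw [hi, hj, ← term]
    gcongr
    rw [taylor_mul, coeff_mul, ← Finset.add_sum_erase _ _
      (show (i, j) ∈ Finset.HasAntidiagonal.antidiagonal (i + j) by simp)]
    have hfin : v ((taylor a f).coeff i * (taylor a g).coeff j) ≠ ⊤ := by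
      intro h
      have := term i j
      rw [h, top_add, ← hi, ← hj, eq_comm, WithTop.add_eq_top] at this
      exact this.elim hf' hg'
    have hlt : v ((taylor a f).coeff i * (taylor a g).coeff j) <
        v (∑ x ∈ (Finset.HasAntidiagonal.antidiagonal (i + j)).erase (i, j),
          (taylor a f).coeff x.1 * (taylor a g).coeff x.2) := by
      refine v.map_lt_sum hfin fun x hx => ?_
      obtain ⟨k, l⟩ := x
      obtain ⟨hne, hkl⟩ := Finset.mem_erase.1 hx
      rw [Finset.HasAntidiagonal.mem_antidiagonal] at hkl
      simp only at hkl ⊢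
      by_contra! hcon
      have h1 : (v ((taylor a f).coeff k) + k • γ) + (v ((taylor a g).coeff l) + l • γ) ≤
          monomialVal v a γ f + monomialVal v a γ g := by
        rw [hi, hj, ← term, ← term, hkl]
        gcongr
      refine absurd h1 (not_le.2 ?_)
      rcases lt_trichotomy k i with h | h | h
      · exact WithTop.add_lt_add_of_lt_of_le hg' (hi' k h) (le_coeff g l)
      · exact absurd (Prod.ext h (by simp; omega)) hne
      · exact WithTop.add_lt_add_of_le_of_lt hf' (le_coeff f k) (hj' l (by omega))
    rw [v.map_add_eq_of_lt_left hlt]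
  · refine le_iff.2 fun n => ?_
    have h : ∀ x ∈ Finset.HasAntidiagonal.antidiagonal n,
        monomialVal v a γ f + monomialVal v a γ g ≤
          v ((taylor a f).coeff x.1 * (taylor a g).coeff x.2) + n • γ := by
      intro x hx
      rw [← Finset.HasAntidiagonal.mem_antidiagonal.1 hx, term]
      exact add_le_add (le_coeff f _) (le_coeff g _)
    rw [taylor_mul, coeff_mul]
    lift γ to Γ using hγ
    -- The ultrametric bound applies to the bare sum, so `n • γ` is moved to the other side and
    -- restored afterwards.
    have key : monomialVal v a γ f + monomialVal v a γ g + ((-(n • γ) : Γ) : WithTop Γ) ≤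
        v (∑ x ∈ Finset.HasAntidiagonal.antidiagonal n,
          (taylor a f).coeff x.1 * (taylor a g).coeff x.2) := by
      refine v.map_le_sum fun x hx => ?_
      refine (add_le_add_left (h x hx) _).trans ?_
      rw [← WithTop.coe_nsmul, add_assoc, ← WithTop.coe_add, add_neg_cancel, WithTop.coe_zero,
        add_zero]
    refine le_trans ?_ (add_le_add_left key _)
    rw [← WithTop.coe_nsmul, add_assoc, ← WithTop.coe_add, neg_add_cancel, WithTop.coe_zero,
      add_zero]

/-- The monomial valuation `v_{a,γ}` with finite `γ` as a valuation on `K[x]`. -/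
def toVal (v : AddValuation K (WithTop Γ)) (a : K) (γ : WithTop Γ) (hγ : γ ≠ ⊤) :
    AddValuation K[X] (WithTop Γ) :=
  AddValuation.of (monomialVal v a γ) map_zero map_one map_add (map_mul hγ)

/-- Minimality of the monomial valuation, by expanding `f` in powers of `x - a`. Comparing `ν_i`
with `ν_j`, or with evaluation at `a_j`, thus reduces to the values of `x - a_i`. -/
theorem le_of_le_map_X_sub_C {Λ : Type*} [AddCommGroup Λ] [LinearOrder Λ] [IsOrderedAddMonoid Λ]
    {e : Γ →+ Λ} (he : Monotone e) {w : AddValuation K[X] (WithTop Λ)}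
    (hw : ∀ c, w (C c) = (v c).map e) (hγ : γ.map e ≤ w (X - C a)) (f : K[X]) :
    (monomialVal v a γ f).map e ≤ w f := by
  conv_rhs => rw [← sum_taylor_eq f a, Polynomial.sum]
  refine w.map_le_sum fun j _ => ?_
  rw [w.map_mul, hw, w.map_pow]
  have h1 := (WithTop.monotone_map_iff.2 he) (le_coeff (v := v) (a := a) (γ := γ) f j)
  have hsm : (j • γ).map e = j • γ.map e :=
    _root_.map_nsmul e.withTopMap j γ
  have h2 : (v ((taylor a f).coeff j) + j • γ).map e =
      (v ((taylor a f).coeff j)).map e + j • γ.map e := by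
    rw [← hsm]
    exact _root_.map_add e.withTopMap _ _
  rw [h2] at h1
  exact h1.trans (by gcongr)

theorem le_of_le_map_X_sub_C' {w : AddValuation K[X] (WithTop Γ)}
    (hw : ∀ c, w (C c) = v c) (hγ : γ ≤ w (X - C a)) (f : K[X]) :
    monomialVal v a γ f ≤ w f := by
  simpa using le_of_le_map_X_sub_C (e := AddMonoidHom.id Γ) monotone_id (by simpa using hw)
    (by simpa using hγ) f

end monomialVal

/-! ### The increasing family `ν_i`; stable and fixed polynomials. -/

namespace PCSeq

variable {K : Type u₁} [Field K] {Γ : Type u₂} [AddCommGroup Γ] [LinearOrder Γ]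
  [IsOrderedAddMonoid Γ] {v : AddValuation K (WithTop Γ)} (s : PCSeq.{u₁, u₂, u₃} v)

theorem lt_succ {i : s.I} (hi : i ∈ s.Istar) : i < s.succ i :=
  letI := SuccOrder.ofLinearWellFoundedLT s.I
  Order.lt_succ_of_not_isMax hi

theorem succ_le {i j : s.I} (h : i < j) : s.succ i ≤ j :=
  letI := SuccOrder.ofLinearWellFoundedLT s.I
  Order.succ_le_of_lt h

theorem mem_Istar_of_lt {i j : s.I} (h : i < j) : i ∈ s.Istar := fun hi => hi.not_lt h

instance : Nonempty s.Istar := by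
  obtain ⟨i, j, h⟩ := exists_pair_lt s.I
  exact ⟨⟨i, s.mem_Istar_of_lt h⟩⟩

theorem val_sub_eq_gam {i j : s.I} (h : i < j) : v (s.a j - s.a i) = s.gam i := by
  rcases (s.succ_le h).eq_or_lt with h' | h'
  · rw [← h', gam]
  · have h1 := s.lt_of_lt i (s.succ i) j (s.lt_succ (s.mem_Istar_of_lt h)) h'
    have h2 := v.map_add_eq_of_lt_left h1
    rw [sub_add_sub_cancel] at h2
    rw [gam, v.map_sub_swap, h2, v.map_sub_swap]

theorem gam_lt_gam {i j : s.I} (h : i < j) (hj : j ∈ s.Istar) : s.gam i < s.gam j := by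
  have h1 := s.lt_of_lt i j _ h (s.lt_succ hj)
  rwa [v.map_sub_swap, s.val_sub_eq_gam h, v.map_sub_swap (s.a j)] at h1

theorem gam_ne_top {i : s.I} (hi : i ∈ s.Istar) : s.gam i ≠ ⊤ := by
  rw [gam, v.ne_top_iff, sub_ne_zero]
  exact fun h => (s.lt_succ hi).ne' (s.injective h)

/-- The monomial valuation `ν_i`, for `i ∈ I*`. -/
def nuVal (i : s.Istar) : AddValuation K[X] (WithTop Γ) :=
  monomialVal.toVal v (s.a i) (s.gam i) (s.gam_ne_top i.2)

theorem nuVal_apply (i : s.Istar) (f : K[X]) : s.nuVal i f = s.nu i f := rfl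

theorem nuVal_C (i : s.Istar) (c : K) : s.nuVal i (C c) = v c := monomialVal.map_C c

theorem nuVal_X_sub_C (i : s.Istar) : s.nuVal i (X - C (s.a i)) = s.gam i :=
  monomialVal.map_X_sub_C

theorem nuVal_eq_top_iff (i : s.Istar) {f : K[X]} : s.nuVal i f = ⊤ ↔ f = 0 :=
  monomialVal.eq_top_iff (s.gam_ne_top i.2)

theorem nuVal_X_sub_C_of_lt {i j : s.Istar} (h : i < j) :
    s.nuVal i (X - C (s.a j)) = s.gam i := by
  refine le_antisymm (monomialVal.map_X_sub_C_le _) ?_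
  have : (X - C (s.a j) : K[X]) = (X - C (s.a i)) - C (s.a j - s.a i) := by
    rw [C_sub]; ring
  rw [this]
  refine (s.nuVal i).map_le_sub (s.nuVal_X_sub_C i).ge ?_
  rw [nuVal_C, s.val_sub_eq_gam h]

theorem gam_le_nuVal {i j : s.Istar} (h : i ≤ j) : s.gam i ≤ s.nuVal j (X - C (s.a i)) := by
  rcases h.eq_or_lt with rfl | h
  · exact (s.nuVal_X_sub_C i).ge
  have : (X - C (s.a i) : K[X]) = (X - C (s.a j)) + C (s.a j - s.a i) := by
    rw [C_sub]; ring
  rw [this]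
  refine (s.nuVal j).map_le_add ?_ ?_
  · rw [nuVal_X_sub_C]
    exact (s.gam_lt_gam h j.2).le
  · rw [nuVal_C, s.val_sub_eq_gam h]

theorem nuVal_mono {i j : s.Istar} (h : i ≤ j) (f : K[X]) : s.nuVal i f ≤ s.nuVal j f :=
  monomialVal.le_of_le_map_X_sub_C' (s.nuVal_C j) (s.gam_le_nuVal h) f

theorem nuVal_le_val_eval {i : s.Istar} {j : s.I} (h : i ≤ j) (f : K[X]) :
    s.nuVal i f ≤ v (f.eval (s.a j)) := by
  refine monomialVal.le_of_le_map_X_sub_C' (w := v.comap (evalRingHom (s.a j)))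
    (fun c => ?_) ?_ f
  · change v ((C c).eval _) = _
    rw [eval_C]
  · change _ ≤ v ((X - C (s.a i)).eval _)
    rw [eval_sub, eval_X, eval_C]
    rcases h.eq_or_lt with h | h
    · rw [h, sub_self, v.map_zero]
      exact le_top
    · exact (s.val_sub_eq_gam h).ge

/-- `x - a_j` divides `f - f(a_j)`, and its value jumps from `γ_i` under `ν_i` to `γ_j` under `ν_j`.
-/
theorem nuVal_lt_nuVal_sub_eval {i j : s.Istar} (h : i < j) {f : K[X]} (hf : f ≠ 0) :
    s.nuVal i f < s.nuVal j (f - C (f.eval (s.a j))) := by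
  have hf' : s.nuVal i f ≠ ⊤ := mt (s.nuVal_eq_top_iff i).1 hf
  obtain ⟨g, hg⟩ := X_sub_C_dvd_sub_C_eval (a := s.a j) (p := f)
  have h1 : s.nuVal i f ≤ s.nuVal i (f - C (f.eval (s.a j))) := by
    refine (s.nuVal i).map_le_sub le_rfl ?_
    rw [nuVal_C]
    exact s.nuVal_le_val_eval h.le f
  rw [hg] at h1 ⊢
  by_cases hg0 : g = 0
  · rw [hg0, mul_zero, AddValuation.map_zero]
    exact lt_top_iff_ne_top.2 hf'
  refine h1.trans_lt ?_
  rw [AddValuation.map_mul, AddValuation.map_mul, s.nuVal_X_sub_C_of_lt h, nuVal_X_sub_C]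
  exact WithTop.add_lt_add_of_lt_of_le (mt (s.nuVal_eq_top_iff i).1 hg0) (s.gam_lt_gam h j.2)
    (s.nuVal_mono h.le g)

/-- `ν_i (f)` is ultimately constant. -/
def Stable (f : K[X]) : Prop := ∃ i, ∀ j, i ≤ j → s.nuVal j f = s.nuVal i f

variable {s}

theorem not_stable {f : K[X]} (h : ¬ s.Stable f) (i : s.Istar) :
    ∃ j, i < j ∧ s.nuVal i f < s.nuVal j f := by
  by_contra! hcon
  refine h ⟨i, fun j hj => le_antisymm ?_ (s.nuVal_mono hj f)⟩
  rcases hj.eq_or_lt with rfl | hj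
  · exact le_rfl
  · exact hcon j hj

theorem stable_of_istarHasMax (h : s.IstarHasMax) (f : K[X]) : s.Stable f := by
  obtain ⟨m, hm, hm'⟩ := h
  refine ⟨⟨m, hm⟩, fun j hj => ?_⟩
  rw [le_antisymm hj (hm' j.2)]

theorem exists_gt (h : ¬ s.IstarHasMax) (i : s.Istar) : ∃ j, i < j := by
  by_contra! hcon
  exact h ⟨i, i.2, fun j hj => hcon ⟨j, hj⟩⟩

theorem stable_zero : s.Stable 0 :=
  ⟨Classical.arbitrary _, fun j _ => by rw [AddValuation.map_zero, AddValuation.map_zero]⟩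

/-- Once `ν_j(f)` is constant, `f - f(a_j)` has larger `ν_j`-value than `f`, so `f` and the constant
`f(a_j)` have the same value. -/
theorem Stable.exists_val_eval_eq (h : ¬ s.IstarHasMax) {f : K[X]} (hf : s.Stable f) :
    ∃ c, ∃ i, ∀ j, i ≤ j → s.nuVal j f = c ∧ v (f.eval (s.a j)) = c := by
  obtain ⟨i, hi⟩ := hf
  obtain ⟨k, hk⟩ := s.exists_gt h i
  refine ⟨s.nuVal i f, k, fun j hj => ⟨hi j (hk.le.trans hj), ?_⟩⟩
  by_cases hf : f = 0
  · simp [hf, AddValuation.map_zero]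
  have h1 := s.nuVal_lt_nuVal_sub_eval (hk.trans_le hj) hf
  rw [← hi j (hk.le.trans hj), AddValuation.map_sub_swap] at h1
  rw [← hi j (hk.le.trans hj), ← (s.nuVal j).map_eq_of_lt_sub h1, nuVal_C]

theorem Stable.fixes (h : ¬ s.IstarHasMax) {f : K[X]} (hf : s.Stable f) : s.Fixes f := by
  obtain ⟨c, i, hi⟩ := hf.exists_val_eval_eq h
  exact ⟨i, i.2, fun j hj hij => by rw [(hi ⟨j, hj⟩ hij).2, (hi i le_rfl).2]⟩

/-- If a sum of elements has larger value than one of its terms, then this value is not the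
minimum, or it is attained twice. -/
theorem _root_.AddValuation.exists_ne_le_of_lt_map_sum {R M ι : Type*} [CommRing R]
    [AddCommGroup M] [LinearOrder M] [IsOrderedAddMonoid M] (w : AddValuation R (WithTop M))
    {t : Finset ι} {f : ι → R} {k : ι} (hk : k ∈ t) (h : w (f k) < w (∑ l ∈ t, f l)) :
    ∃ l ∈ t, l ≠ k ∧ w (f l) ≤ w (f k) := by
  classical
  by_contra! hcon
  have h1 : w (f k) < w (∑ l ∈ t.erase k, f l) :=
    w.map_lt_sum h.ne_top fun l hl =>
      hcon l (Finset.mem_of_mem_erase hl) (Finset.ne_of_mem_erase hl)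
  rw [← Finset.add_sum_erase _ _ hk, w.map_add_eq_of_lt_left h1] at h
  exact h.false

/-- Kaplansky's argument. The Hasse derivatives of `f` have lower degree, so their values at `a_i`
are ultimately constants `c k`. If `v(f(a_i))` were constant too, then `f(a_j) - f(a_i)` would have
larger value than the least term `c k + k γ_i` of its Taylor sum, so two terms would tie. A tie
determines `γ_i`, but there are infinitely many `γ_i` and finitely many pairs of exponents. -/
theorem not_fixes_of_minimal (h : ¬ s.IstarHasMax) {f : K[X]} (hf : ¬ s.Stable f)
    (hmin : ∀ g : K[X], g.natDegree < f.natDegree → s.Stable g) : ¬ s.Fixes f := by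
  rintro ⟨i₀, hi₀, hfix⟩
  have hdeg : 0 < f.natDegree := by
    by_contra! h0
    obtain ⟨c, rfl⟩ := natDegree_eq_zero.1 (le_antisymm h0 zero_le)
    exact hf ⟨Classical.arbitrary _, fun j _ => by rw [nuVal_C, nuVal_C]⟩
  -- ultimately, all values of the derivatives of `f` are constant
  have hder : ∀ k, 0 < k → ∃ c : WithTop Γ, ∀ᶠ i : s.Istar in Filter.atTop,
      v ((taylor (s.a i) f).coeff k) = c := by
    intro k hk
    have hst : s.Stable (hasseDeriv k f) := by
      refine hmin _ ((natDegree_hasseDeriv_le f k).trans_lt ?_)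
      omega
    obtain ⟨c, i, hi⟩ := hst.exists_val_eval_eq h
    refine ⟨c, Filter.eventually_atTop.2 ⟨i, fun j hj => ?_⟩⟩
    rw [taylor_coeff]
    exact (hi j hj).2
  choose! c hc using hder
  have hall : ∀ᶠ i : s.Istar in Filter.atTop, ∀ k ∈ Finset.Icc 1 f.natDegree,
      v ((taylor (s.a i) f).coeff k) = c k :=
    (Filter.eventually_all_finset _).2 fun k hk => hc k (Finset.mem_Icc.1 hk).1
  obtain ⟨i₁, hi₁⟩ := Filter.eventually_atTop.1
    (hall.and (Filter.eventually_ge_atTop (⟨i₀, hi₀⟩ : s.Istar)))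
  -- beyond `i₁`, the minimum of the values `c k + k γ_i` is attained twice
  have htwice : ∀ i : Set.Ici i₁, ∃ p ∈ Finset.Icc 1 f.natDegree ×ˢ Finset.Icc 1 f.natDegree,
      p.1 ≠ p.2 ∧ c p.1 + p.1 • s.gam i = c p.2 + p.2 • s.gam i ∧
        c p.1 + p.1 • s.gam i ≠ ⊤ := by
    rintro ⟨i, hi⟩
    obtain ⟨j, hij, hlt⟩ := s.not_stable hf i
    have hvi : v (f.eval (s.a i)) = v (f.eval (s.a i₀)) := hfix i i.2 (hi₁ i hi).2
    have hvj : v (f.eval (s.a j)) = v (f.eval (s.a i₀)) :=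
      hfix j j.2 ((hi₁ i hi).2.trans hij.le)
    have hlt' : s.nuVal i f < v (f.eval (s.a i₀)) :=
      hlt.trans_le ((s.nuVal_le_val_eval le_rfl f).trans hvj.le)
    obtain ⟨k, hk⟩ := monomialVal.exists_eq v (s.a i) (s.gam i) f
    change s.nuVal i f = _ at hk
    -- The constant term has the fixed value, which exceeds `ν_i(f)`; the minimum is therefore
    -- attained at a positive index.
    have hk0 : k ≠ 0 := by
      rintro rfl
      rw [taylor_coeff_zero, zero_nsmul, add_zero, hvi] at hk
      exact hlt'.ne hk
    have hkn : k ≤ f.natDegree := by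
      by_contra! hcon
      rw [coeff_eq_zero_of_natDegree_lt (by rwa [natDegree_taylor]), v.map_zero, top_add] at hk
      exact hlt'.ne_top hk
    have hsum : f.eval (s.a j) - f.eval (s.a i) = ∑ l ∈ Finset.Icc 1 f.natDegree,
        (taylor (s.a i) f).coeff l * (s.a j - s.a i) ^ l := by
      have h1 : f.eval (s.a j) = (taylor (s.a i) f).eval (s.a j - s.a i) := by
        rw [taylor_eval, sub_add_cancel]
      rw [h1, eval_eq_sum_range, natDegree_taylor, Finset.sum_range_succ', pow_zero, mul_one,
        taylor_coeff_zero, add_sub_cancel_right, Finset.range_eq_Ico,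
        Finset.sum_Ico_add' (fun l => (taylor (s.a i) f).coeff l * (s.a j - s.a i) ^ l)]
      rfl
    have hterm : ∀ l ∈ Finset.Icc 1 f.natDegree,
        v ((taylor (s.a i) f).coeff l * (s.a j - s.a i) ^ l) = c l + l • s.gam i := by
      intro l hl
      rw [v.map_mul, v.map_pow, (hi₁ i hi).1 l hl, s.val_sub_eq_gam hij]
    have hkm : k ∈ Finset.Icc 1 f.natDegree := Finset.mem_Icc.2 ⟨by omega, hkn⟩
    have hk' : s.nuVal i f = c k + k • s.gam i := by rw [hk, (hi₁ i hi).1 k hkm]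
    obtain ⟨l, hl, hlk, hle⟩ := v.exists_ne_le_of_lt_map_sum hkm
      (f := fun l => (taylor (s.a i) f).coeff l * (s.a j - s.a i) ^ l) (by
        rw [hterm k hkm, ← hk', ← hsum]
        exact hlt'.trans_le (v.map_le_sub hvj.ge hvi.ge))
    refine ⟨(k, l), Finset.mem_product.2 ⟨hkm, hl⟩, hlk.symm, le_antisymm ?_ ?_, ?_⟩
    · rw [← hk', ← hterm l hl, v.map_mul, v.map_pow, s.val_sub_eq_gam hij]
      exact monomialVal.le_coeff f l
    · simp only [hterm l hl, hterm k hkm] at hle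
      exact hle
    · rw [← hk']
      exact hlt'.ne_top
  choose p hp hne heq htop using htwice
  have : Infinite (Set.Ici i₁) := by
    have : NoMaxOrder s.Istar := ⟨s.exists_gt h⟩
    infer_instance
  -- Pigeonhole: the same pair of exponents ties at two different indices. Subtracting the two
  -- relations leaves a nonzero integer multiple of the difference of the two `γ`, and `Γ` is
  -- torsion-free.
  obtain ⟨x, y, hxy, hpxy⟩ := Finite.exists_ne_map_eq_of_infinite
    fun x => (⟨p x, hp x⟩ : {q // q ∈ Finset.Icc 1 f.natDegree ×ˢ Finset.Icc 1 f.natDegree})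
  have hpxy' : p x = p y := congrArg Subtype.val hpxy
  obtain ⟨b₁, hb₁⟩ := WithTop.ne_top_iff_exists.1 (WithTop.add_ne_top.1 (htop x)).1
  obtain ⟨b₂, hb₂⟩ := WithTop.ne_top_iff_exists.1 (WithTop.add_ne_top.1 (heq x ▸ htop x)).1
  obtain ⟨g, hg⟩ := WithTop.ne_top_iff_exists.1 (s.gam_ne_top x.1.2)
  obtain ⟨g', hg'⟩ := WithTop.ne_top_iff_exists.1 (s.gam_ne_top y.1.2)
  have e1 := heq x
  have e2 := heq y
  rw [← hpxy'] at e2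
  rw [← hb₁, ← hb₂, ← hg] at e1
  rw [← hb₁, ← hb₂, ← hg'] at e2
  norm_cast at e1 e2
  have e3 : ((p x).1 : ℤ) • (g - g') = ((p x).2 : ℤ) • (g - g') := by
    rw [natCast_zsmul, natCast_zsmul, nsmul_sub, nsmul_sub, sub_eq_sub_iff_add_eq_add]
    have := congrArg₂ (· - ·) e1 e2
    simp only [add_sub_add_left_eq_sub] at this
    rw [sub_eq_sub_iff_add_eq_add] at this
    exact this
  have hgg : g = g' := by
    rw [← sub_eq_zero, ← sub_smul] at e3
    rcases smul_eq_zero.1 e3 with h0 | h0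
    · exact absurd (by omega) (hne x)
    · exact sub_eq_zero.1 h0
  rcases lt_or_gt_of_ne hxy with hlt | hlt
  · exact (s.gam_lt_gam hlt y.1.2).ne (by rw [← hg, ← hg', hgg])
  · exact (s.gam_lt_gam hlt x.1.2).ne (by rw [← hg, ← hg', hgg])

theorem stable_of_forall_fixes (h : ¬ s.IstarHasMax) {n : ℕ}
    (hfix : ∀ g : K[X], g.natDegree < n → s.Fixes g) {f : K[X]} (hf : f.natDegree < n) :
    s.Stable f := by
  induction hd : f.natDegree using Nat.strong_induction_on generalizing f with
  | _ d ih =>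
    by_contra hns
    exact not_fixes_of_minimal h hns (fun g hg => ih _ (hd ▸ hg) (hg.trans hf) rfl) (hfix f hf)

end PCSeq

/-! ### Limits of increasing families of valuations -/

namespace LimitVal

set_option linter.unusedSectionVars false

variable {R : Type*} [CommRing R] {Γ : Type*} [AddCommGroup Γ] [LinearOrder Γ]
  [IsOrderedAddMonoid Γ] {T : Type*} [LinearOrder T] [Nonempty T]

variable (T) in
/-- An ultrafilter on `T` that contains all final segments. -/
def ultra : Ultrafilter T := Ultrafilter.of Filter.atTop

theorem eventually_ge (t : T) : ∀ᶠ u in (ultra T : Filter T), t ≤ u :=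
  Ultrafilter.of_le Filter.atTop (Filter.eventually_ge_atTop t)

theorem exists_ge_of_eventually {p : T → Prop} (h : ∀ᶠ u in (ultra T : Filter T), p u) (t : T) :
    ∃ u, t ≤ u ∧ p u :=
  ((eventually_ge t).and h).exists

variable (w : T → AddValuation R (WithTop Γ))

/-- The values of `f` are bounded by an element of `Γ`. -/
def Bdd (f : R) : Prop := ∃ g : Γ, ∀ t, w t f ≤ g

open Classical in
/-- The germ of the values of `f` if these are bounded, `∞` otherwise. -/
def fn (f : R) : WithTop (Filter.Germ (ultra T : Filter T) Γ) :=
  if Bdd w f then (((fun t => (w t f).untopD 0 : T → Γ) :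
    Filter.Germ (ultra T : Filter T) Γ) : WithTop (Filter.Germ (ultra T : Filter T) Γ)) else ⊤

variable {w}

theorem coe_untopD {f : R} (hf : Bdd w f) (t : T) :
    (((w t f).untopD 0 : Γ) : WithTop Γ) = w t f := by
  obtain ⟨g, hg⟩ := hf
  obtain ⟨b, hb⟩ := WithTop.ne_top_iff_exists.1 ((hg t).trans_lt (WithTop.coe_lt_top g)).ne
  rw [← hb, WithTop.untopD_coe]

theorem fn_of_bdd {f : R} (hf : Bdd w f) : fn w f = (((fun t => (w t f).untopD 0 : T → Γ) :
    Filter.Germ (ultra T : Filter T) Γ) : WithTop (Filter.Germ (ultra T : Filter T) Γ)) :=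
  if_pos hf

theorem fn_of_not_bdd {f : R} (hf : ¬ Bdd w f) : fn w f = ⊤ := if_neg hf

theorem bdd_of_eventually_le (hw : ∀ f, Monotone fun t => w t f) {f : R} {g : Γ}
    (h : ∀ᶠ t in (ultra T : Filter T), w t f ≤ g) : Bdd w f :=
  ⟨g, fun t => let ⟨_, hu, hg⟩ := exists_ge_of_eventually h t; (hw f hu).trans hg⟩

theorem fn_le_fn (hw : ∀ f, Monotone fun t => w t f) {f g : R}
    (h : ∀ᶠ t in (ultra T : Filter T), w t f ≤ w t g) : fn w f ≤ fn w g := by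
  by_cases hg : Bdd w g
  · have hf : Bdd w f := by
      obtain ⟨b, hb⟩ := hg
      exact bdd_of_eventually_le hw (h.mono fun t ht => ht.trans (hb t))
    rw [fn_of_bdd hg, fn_of_bdd hf, WithTop.coe_le_coe, Filter.Germ.coe_le]
    filter_upwards [h] with t ht
    rwa [← WithTop.coe_le_coe, coe_untopD hg, coe_untopD hf]
  · rw [fn_of_not_bdd hg]
    exact le_top

/-- For each `t` one of the two summands has value at most that of the sum; the ultrafilter selects
one summand that works for almost all `t`. -/
theorem fn_add (hw : ∀ f, Monotone fun t => w t f) (f g : R) :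
    min (fn w f) (fn w g) ≤ fn w (f + g) := by
  have : ∀ᶠ t in (ultra T : Filter T), w t f ≤ w t (f + g) ∨ w t g ≤ w t (f + g) :=
    .of_forall fun t => (w t).map_add' f g
  rw [min_le_iff]
  exact (Ultrafilter.eventually_or.1 this).imp (fn_le_fn hw) (fn_le_fn hw)

/-- The values of `g` stay above the finite value `w t₀ g`, so subtracting it from a bound for `f *
g` bounds `f`. -/
theorem bdd_of_mul (hw : ∀ f, Monotone fun t => w t f) {f g : R} (h : Bdd w (f * g)) :
    Bdd w f := by
  obtain ⟨b, hb⟩ := h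
  have t₀ : T := Classical.arbitrary T
  have hg : w t₀ g ≠ ⊤ := by
    intro h0
    have h1 := hb t₀
    rw [(w t₀).map_mul, h0, add_top, top_le_iff] at h1
    exact WithTop.coe_ne_top h1
  obtain ⟨m, hm⟩ := WithTop.ne_top_iff_exists.1 hg
  refine bdd_of_eventually_le (g := b - m) hw ((eventually_ge t₀).mono fun t ht => ?_)
  have h1 : w t f + m ≤ b := by
    refine le_trans ?_ (hb t)
    rw [(w t).map_mul, hm]
    exact add_le_add_right (hw g ht) _
  cases hf : w t f with
  | top => rw [hf, top_add, top_le_iff] at h1; exact absurd h1 WithTop.coe_ne_top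
  | coe x =>
    rw [hf] at h1
    norm_cast at h1 ⊢
    exact le_sub_iff_add_le.2 h1

theorem bdd_mul {f g : R} (hf : Bdd w f) (hg : Bdd w g) : Bdd w (f * g) := by
  obtain ⟨b, hb⟩ := hf
  obtain ⟨c, hc⟩ := hg
  refine ⟨b + c, fun t => ?_⟩
  rw [(w t).map_mul]
  exact add_le_add (hb t) (hc t)

theorem fn_mul (hw : ∀ f, Monotone fun t => w t f) (f g : R) :
    fn w (f * g) = fn w f + fn w g := by
  by_cases h : Bdd w (f * g)
  · have hf : Bdd w f := bdd_of_mul hw h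
    have hg : Bdd w g := bdd_of_mul (g := f) hw (by rwa [mul_comm])
    rw [fn_of_bdd h, fn_of_bdd hf, fn_of_bdd hg, ← WithTop.coe_add, ← Filter.Germ.coe_add]
    congr 2
    funext t
    rw [← WithTop.coe_inj, coe_untopD h, (w t).map_mul, Pi.add_apply, WithTop.coe_add,
      coe_untopD hf, coe_untopD hg]
  · rw [fn_of_not_bdd h, eq_comm, WithTop.add_eq_top]
    by_contra! hcon
    refine h (bdd_mul ?_ ?_)
    · exact not_imp_comm.1 fn_of_not_bdd hcon.1
    · exact not_imp_comm.1 fn_of_not_bdd hcon.2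

theorem fn_eq_coe {f : R} {g : Γ} (h : ∀ t, w t f = g) : fn w f =
    ((((g : Γ) : Filter.Germ (ultra T : Filter T) Γ)) :
      WithTop (Filter.Germ (ultra T : Filter T) Γ)) := by
  rw [fn_of_bdd ⟨g, fun t => (h t).le⟩]
  simp only [h, WithTop.untopD_coe]
  rfl

theorem fn_eq_top {f : R} (h : ∀ t, w t f = ⊤) : fn w f = ⊤ := by
  refine fn_of_not_bdd fun ⟨g, hg⟩ => ?_
  have := hg (Classical.arbitrary T)
  rw [h, top_le_iff] at this
  exact WithTop.coe_ne_top this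

variable (w) in
/-- The limit of an increasing family of valuations. -/
def toVal (hw : ∀ f, Monotone fun t => w t f) :
    AddValuation R (WithTop (Filter.Germ (ultra T : Filter T) Γ)) :=
  AddValuation.of (fn w) (fn_eq_top fun t => (w t).map_zero)
    (by rw [fn_eq_coe (g := 0) fun t => (w t).map_one]; rfl) (fn_add hw) (fn_mul hw)

variable (Γ T) in
/-- The embedding of `Γ` by constant germs. -/
def emb : Γ →+ Filter.Germ (ultra T : Filter T) Γ where
  toFun g := (g : Filter.Germ (ultra T : Filter T) Γ)
  map_zero' := rfl
  map_add' _ _ := rfl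

/-- By monotonicity, an upper bound valid for almost all `t` holds for all `t`. -/
theorem fn_le_coe_iff (hw : ∀ f, Monotone fun t => w t f) {f : R} {g : Γ} :
    fn w f ≤ ((emb Γ T g : Filter.Germ (ultra T : Filter T) Γ) :
      WithTop (Filter.Germ (ultra T : Filter T) Γ)) ↔
      ∀ t, w t f ≤ g := by
  constructor
  · intro h t
    have hb : Bdd w f := by
      by_contra hb
      rw [fn_of_not_bdd hb, top_le_iff] at h
      exact WithTop.coe_ne_top h
    rw [fn_of_bdd hb, WithTop.coe_le_coe] at h
    obtain ⟨u, htu, hu⟩ := exists_ge_of_eventually (Filter.Germ.coe_le.1 h) t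
    refine (hw f htu).trans ?_
    exact (coe_untopD hb u).symm.trans_le (WithTop.coe_le_coe.2 hu)
  · intro h
    have hb : Bdd w f := ⟨g, h⟩
    rw [fn_of_bdd hb, WithTop.coe_le_coe]
    refine Filter.Germ.coe_le.2 (.of_forall fun t => ?_)
    rw [← WithTop.coe_le_coe, coe_untopD hb]
    exact h t

theorem coe_le_fn_iff (hw : ∀ f, Monotone fun t => w t f) {f : R} {g : Γ} :
    ((emb Γ T g : Filter.Germ (ultra T : Filter T) Γ) :
      WithTop (Filter.Germ (ultra T : Filter T) Γ)) ≤ fn w f ↔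
      ∃ t, (g : WithTop Γ) ≤ w t f := by
  by_cases hb : Bdd w f
  · rw [fn_of_bdd hb, WithTop.coe_le_coe]
    constructor
    · intro h
      obtain ⟨u, hu⟩ := (Filter.Germ.coe_le.1 h).exists
      refine ⟨u, ?_⟩
      rw [← coe_untopD hb u]
      exact WithTop.coe_le_coe.2 hu
    · rintro ⟨t, ht⟩
      refine Filter.Germ.coe_le.2 ((eventually_ge t).mono fun u hu => ?_)
      rw [← WithTop.coe_le_coe, coe_untopD hb]
      exact ht.trans (hw f hu)
  · refine iff_of_true ((fn_of_not_bdd hb).symm ▸ le_top) ?_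
    by_contra! hcon
    exact hb ⟨g, fun t => (hcon t).le⟩

theorem emb_strictMono : StrictMono (emb Γ T) := fun _ _ h => Filter.Germ.const_lt h

end LimitVal

/-! ### Membership in the quasi-cut of an element. -/

namespace QuasiCut

set_option linter.unusedSectionVars false

variable {Γ : Type*} [AddCommGroup Γ] [LinearOrder Γ] [IsOrderedAddMonoid Γ]
  {Λ : Type*} [AddCommGroup Λ] [LinearOrder Λ] [IsOrderedAddMonoid Λ]
  {e : Γ →+ Λ} {he : StrictMono e} {α : WithTop Λ}

theorem nsmul_le_nsmul_iff {m : ℕ} (hm : m ≠ 0) {x y : WithTop Λ} : m • x ≤ m • y ↔ x ≤ y := by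
  refine ⟨fun h => ?_, fun h => nsmul_le_nsmul_right h m⟩
  cases y with
  | top => exact le_top
  | coe y =>
    cases x with
    | top =>
      obtain ⟨k, rfl⟩ := Nat.exists_eq_succ_of_ne_zero hm
      rw [succ_nsmul, add_top, top_le_iff, ← WithTop.coe_nsmul] at h
      exact absurd h WithTop.coe_ne_top
    | coe x =>
      norm_cast at h ⊢
      exact (_root_.nsmul_le_nsmul_iff_right hm).1 h

theorem nsmul_coe_map (e : Γ →+ Λ) (m : ℕ) (g : Γ) :
    (((e (m • g) : Λ)) : WithTop Λ) = m • ((e g : Λ) : WithTop Λ) := by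
  rw [map_nsmul, WithTop.coe_nsmul]

/-- The definition asks for some representative of the fraction; cross-multiplying shows that any
representative will do. -/
theorem mk_mem_left {g : Γ} {n : ℕ+} : DivisibleHull.mk g n ∈ (ofElement e he α).left ↔
    ((e g : Λ) : WithTop Λ) ≤ (n : ℕ) • α := by
  refine ⟨?_, fun h => ⟨g, n, rfl, h⟩⟩
  rintro ⟨g', n', h, hg'⟩
  rw [DivisibleHull.mk_eq_mk_iff_smul_eq_smul] at h
  have h1 := nsmul_le_nsmul_right hg' (n : ℕ)
  rw [← nsmul_coe_map] at h1
  have h2 : (n : ℕ) • g' = (n' : ℕ) • g := h.symm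
  rw [h2, nsmul_coe_map, smul_comm] at h1
  exact (nsmul_le_nsmul_iff n'.ne_zero).1 h1

theorem mk_mem_right {g : Γ} {n : ℕ+} : DivisibleHull.mk g n ∈ (ofElement e he α).right ↔
    (n : ℕ) • α ≤ ((e g : Λ) : WithTop Λ) := by
  refine ⟨?_, fun h => ⟨g, n, rfl, h⟩⟩
  rintro ⟨g', n', h, hg'⟩
  rw [DivisibleHull.mk_eq_mk_iff_smul_eq_smul] at h
  have h1 := nsmul_le_nsmul_right hg' (n : ℕ)
  rw [← nsmul_coe_map] at h1
  have h2 : (n : ℕ) • g' = (n' : ℕ) • g := h.symm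
  rw [h2, nsmul_coe_map, smul_comm] at h1
  exact (nsmul_le_nsmul_iff n'.ne_zero).1 h1

theorem subset_left_iff {δ : QuasiCut Γ} : (ofElement e he α).left ⊆ δ.left ↔
    ∀ (g : Γ) (n : ℕ+), ((e g : Λ) : WithTop Λ) ≤ (n : ℕ) • α → DivisibleHull.mk g n ∈ δ.left :=
  ⟨fun h _ _ hg => h (mk_mem_left.2 hg), fun h => by rintro _ ⟨g, n, rfl, hg⟩; exact h g n hg⟩

theorem subset_right_iff {δ : QuasiCut Γ} : (ofElement e he α).right ⊆ δ.right ↔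
    ∀ (g : Γ) (n : ℕ+), (n : ℕ) • α ≤ ((e g : Λ) : WithTop Λ) → DivisibleHull.mk g n ∈ δ.right :=
  ⟨fun h _ _ hg => h (mk_mem_right.2 hg), fun h => by rintro _ ⟨g, n, rfl, hg⟩; exact h g n hg⟩

theorem ofElement_eq_top_iff : ofElement e he α = ⊤ ↔
    ∀ (g : Γ) (n : ℕ+), ¬ (n : ℕ) • α ≤ ((e g : Λ) : WithTop Λ) := by
  constructor
  · intro h g n hg
    have : DivisibleHull.mk g n ∈ (ofElement e he α).right := mk_mem_right.2 hg
    rw [h] at this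
    exact this
  · intro h
    have hr : (ofElement e he α).right = ∅ := by
      refine Set.eq_empty_of_forall_notMem ?_
      rintro _ ⟨g, n, rfl, hg⟩
      exact h g n hg
    have hl := (ofElement e he α).cover
    rw [hr, Set.union_empty] at hl
    exact QuasiCut.ext hl hr

end QuasiCut

/-! ### Existence of the supremum and its description by `IsLim`. -/

namespace PCSeq

variable {K : Type u₁} [Field K] {Γ : Type u₂} [AddCommGroup Γ] [LinearOrder Γ]
  [IsOrderedAddMonoid Γ] {v : AddValuation K (WithTop Γ)} (s : PCSeq.{u₁, u₂, u₃} v)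

/-- The set of the `γ_i`, `i ∈ I*`, which has the order type of `I*`. -/
abbrev Gams : Type u₂ := {g : Γ // ∃ i : s.Istar, s.gam i = g}

/-- The index `i` of an element `γ_i`. -/
def idx (t : s.Gams) : s.Istar := t.2.choose

theorem gam_idx (t : s.Gams) : s.gam (s.idx t) = (t.1 : WithTop Γ) := t.2.choose_spec

theorem idx_mono : Monotone s.idx := by
  intro t u h
  by_contra! hcon
  have h1 := s.gam_lt_gam hcon (s.idx t).2
  rw [gam_idx, gam_idx, WithTop.coe_lt_coe] at h1
  exact absurd h (not_le.2 h1)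

theorem idx_surjective : Function.Surjective s.idx := by
  intro i
  obtain ⟨g, hg⟩ := WithTop.ne_top_iff_exists.1 (s.gam_ne_top i.2)
  refine ⟨⟨g, i, hg.symm⟩, ?_⟩
  have h1 := s.gam_idx ⟨g, i, hg.symm⟩
  by_contra hne
  rcases lt_or_gt_of_ne hne with h | h
  · exact (s.gam_lt_gam h i.2).ne (by rw [h1, hg])
  · exact (s.gam_lt_gam h (s.idx _).2).ne (by rw [h1, hg])

instance : Nonempty s.Gams :=
  let ⟨t, _⟩ := s.idx_surjective (Classical.arbitrary _)
  ⟨t⟩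

theorem nuVal_idx_mono (f : K[X]) : Monotone fun t => s.nuVal (s.idx t) f :=
  fun _ _ h => s.nuVal_mono (s.idx_mono h) f

/-- The limit of the valuations `ν_i`. -/
def limVal : ExtVal v where
  -- Germs over the subset `Gams` of `Γ`, instead of `I*`, keep this group in the universe of `Γ`
  -- that `ExtVal` prescribes.
  Λ := Filter.Germ (LimitVal.ultra s.Gams : Filter s.Gams) Γ
  emb := LimitVal.emb Γ s.Gams
  emb_strictMono := LimitVal.emb_strictMono
  val := LimitVal.toVal (fun t => s.nuVal (s.idx t)) s.nuVal_idx_mono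
  val_C c := by
    change LimitVal.fn _ _ = _
    cases hc : v c with
    | top => exact LimitVal.fn_eq_top fun t => by rw [nuVal_C, hc]
    | coe g => exact LimitVal.fn_eq_coe fun t => by rw [nuVal_C, hc]

/-- The quasi-cuts of the values of `μ` are the suprema of the values of the `ν_i`. -/
structure IsLim (μ : ExtVal v) : Prop where
  le_iff : ∀ (f : K[X]) (g : Γ) (n : ℕ), n ≠ 0 →
    (((μ.emb g : μ.Λ) : WithTop μ.Λ) ≤ n • μ.val f ↔
      ∃ i : s.Istar, (g : WithTop Γ) ≤ n • s.nuVal i f)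
  ge_iff : ∀ (f : K[X]) (g : Γ) (n : ℕ), n ≠ 0 →
    (n • μ.val f ≤ ((μ.emb g : μ.Λ) : WithTop μ.Λ) ↔ ∀ i : s.Istar, n • s.nuVal i f ≤ g)
  eq_top : ∀ f : K[X], (∀ g : Γ, ∃ i, ¬ s.nuVal i f ≤ g) → μ.val f = ⊤

theorem isLim_limVal : s.IsLim s.limVal where
  le_iff f g n hn := by
    -- Replacing `f` by `f ^ n` turns a comparison with `g / n` into one with `g`.
    rw [← AddValuation.map_pow, s.idx_surjective.exists]
    simp only [← AddValuation.map_pow]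
    exact LimitVal.coe_le_fn_iff s.nuVal_idx_mono
  ge_iff f g n hn := by
    rw [← AddValuation.map_pow, s.idx_surjective.forall]
    simp only [← AddValuation.map_pow]
    exact LimitVal.fn_le_coe_iff s.nuVal_idx_mono
  eq_top f h := by
    refine LimitVal.fn_of_not_bdd fun ⟨g, hg⟩ => ?_
    obtain ⟨i, hi⟩ := h g
    obtain ⟨t, rfl⟩ := s.idx_surjective i
    exact hi (hg t)

theorem map_emb_nsmul (μ : ExtVal v) (n : ℕ) (x : WithTop Γ) :
    (n • x).map μ.emb = n • x.map μ.emb :=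
  _root_.map_nsmul μ.emb.withTopMap n x

theorem map_emb_le_map_emb (μ : ExtVal v) {x y : WithTop Γ} :
    x.map μ.emb ≤ y.map μ.emb ↔ x ≤ y :=
  WithTop.map_le_iff _ fun {_ _} => μ.emb_strictMono.le_iff_le

variable {s}

theorem IsLim.isSup {μ : ExtVal v} (h : s.IsLim μ) : μ.IsSup s := by
  refine ⟨fun i hi f => ?_, fun μ' hμ' f => ⟨?_, ?_⟩, fun f hf => ?_⟩
  · cases hf : s.nu i f with
    | top =>
      have h0 : f = 0 := (s.nuVal_eq_top_iff ⟨i, hi⟩).1 hf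
      rw [h0, AddValuation.map_zero]
      exact le_top
    | coe g =>
      have := (h.le_iff f g 1 one_ne_zero).2 ⟨⟨i, hi⟩, by rw [one_nsmul, nuVal_apply, hf]⟩
      rwa [one_nsmul] at this
  · refine QuasiCut.subset_left_iff.2 fun g n hg => QuasiCut.mk_mem_left.2 ?_
    obtain ⟨i, hi⟩ := (h.le_iff f g n n.ne_zero).1 hg
    refine ((map_emb_le_map_emb μ').2 hi).trans ?_
    rw [map_emb_nsmul]
    exact nsmul_le_nsmul_right (hμ' i i.2 f) _
  · refine QuasiCut.subset_right_iff.2 fun g n hg => QuasiCut.mk_mem_right.2 ?_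
    refine (h.ge_iff f g n n.ne_zero).2 fun i => ?_
    rw [← map_emb_le_map_emb μ', map_emb_nsmul]
    exact (nsmul_le_nsmul_right (hμ' i i.2 f) _).trans hg
  · refine h.eq_top f fun g => ?_
    by_contra! hcon
    have h1 := (h.ge_iff f g 1 one_ne_zero).2 (by simpa using hcon)
    exact QuasiCut.ofElement_eq_top_iff.1 hf g 1 h1

/-- Two suprema bound each other, so `μ` has the same cuts as `limVal`; the convention on `∞` then
supplies the last field. -/
theorem _root_.ExtVal.IsSup.isLim {μ : ExtVal v} (h : μ.IsSup s) : s.IsLim μ := by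
  have hlim := s.isLim_limVal
  have hcut : ∀ f, μ.cut f = s.limVal.cut f := fun f =>
    le_antisymm (h.2.1 _ hlim.isSup.1 f) (hlim.isSup.2.1 _ h.1 f)
  have hle : ∀ (f : K[X]) (g : Γ) (n : ℕ), n ≠ 0 →
      (((μ.emb g : μ.Λ) : WithTop μ.Λ) ≤ n • μ.val f ↔
        ∃ i : s.Istar, (g : WithTop Γ) ≤ n • s.nuVal i f) := by
    intro f g n hn
    rw [← hlim.le_iff f g n hn]
    lift n to ℕ+ using Nat.pos_of_ne_zero hn
    have h1 := congrArg (fun δ => DivisibleHull.mk g n ∈ δ.left) (hcut f)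
    exact QuasiCut.mk_mem_left.symm.trans ((iff_of_eq h1).trans QuasiCut.mk_mem_left)
  have hge : ∀ (f : K[X]) (g : Γ) (n : ℕ), n ≠ 0 →
      (n • μ.val f ≤ ((μ.emb g : μ.Λ) : WithTop μ.Λ) ↔ ∀ i : s.Istar, n • s.nuVal i f ≤ g) := by
    intro f g n hn
    rw [← hlim.ge_iff f g n hn]
    lift n to ℕ+ using Nat.pos_of_ne_zero hn
    have h1 := congrArg (fun δ => DivisibleHull.mk g n ∈ δ.right) (hcut f)
    exact QuasiCut.mk_mem_right.symm.trans ((iff_of_eq h1).trans QuasiCut.mk_mem_right)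
  refine ⟨hle, hge, fun f hf => h.2.2 f ?_⟩
  rw [hcut]
  refine QuasiCut.ofElement_eq_top_iff.2 fun g n hg => ?_
  have h1 : s.limVal.val f = ⊤ := hlim.eq_top f hf
  rw [h1, ← PNat.natPred_add_one, succ_nsmul, add_top, top_le_iff] at hg
  exact WithTop.coe_ne_top hg

/-- Surjectivity of `v` makes every `g` the value of a constant polynomial, so each condition
compares values of two polynomials and passes to equivalent valuations. -/
theorem IsLim.of_equiv (hv : Function.Surjective v) {μ μ' : ExtVal v} (h : s.IsLim μ)
    (hμ : μ.val.IsEquiv μ'.val) : s.IsLim μ' where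
  le_iff f g n hn := by
    obtain ⟨c, hc⟩ := hv g
    have h1 : ∀ ν : ExtVal v, ((ν.emb g : ν.Λ) : WithTop ν.Λ) = ν.val (C c) := fun ν => by
      rw [ν.val_C, hc, WithTop.map_coe]
    rw [← h.le_iff f g n hn, h1, h1, ← AddValuation.map_pow, ← AddValuation.map_pow]
    exact (hμ (f ^ n) (C c)).symm
  ge_iff f g n hn := by
    obtain ⟨c, hc⟩ := hv g
    have h1 : ∀ ν : ExtVal v, ((ν.emb g : ν.Λ) : WithTop ν.Λ) = ν.val (C c) := fun ν => by
      rw [ν.val_C, hc, WithTop.map_coe]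
    rw [← h.ge_iff f g n hn, h1, h1, ← AddValuation.map_pow, ← AddValuation.map_pow]
    exact (hμ (C c) (f ^ n)).symm
  eq_top f hf := by
    by_contra hcon
    exact hμ.ne_top.2 hcon (h.eq_top f hf)

theorem IsLim.val_of_stable {μ : ExtVal v} (h : s.IsLim μ) {f : K[X]} {i : s.Istar}
    (hi : ∀ j, i ≤ j → s.nuVal j f = s.nuVal i f) : μ.val f = (s.nuVal i f).map μ.emb := by
  cases hg : s.nuVal i f with
  | top =>
    rw [(s.nuVal_eq_top_iff i).1 hg, AddValuation.map_zero]
    rfl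
  | coe g =>
    have h1 := (h.le_iff f g 1 one_ne_zero).2 ⟨i, by rw [one_nsmul, hg]⟩
    have h2 := (h.ge_iff f g 1 one_ne_zero).2 fun j => by
      rw [one_nsmul, ← hg, ← hi _ (le_max_left i j)]
      exact s.nuVal_mono (le_max_right i j) f
    rw [one_nsmul] at h1 h2
    exact le_antisymm h2 h1

theorem Stable.exists_val_eq {f : K[X]} (hf : s.Stable f) (hf0 : f ≠ 0) :
    ∃ g : Γ, ∀ μ : ExtVal v, s.IsLim μ → μ.val f = ((μ.emb g : μ.Λ) : WithTop μ.Λ) := by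
  obtain ⟨i, hi⟩ := hf
  obtain ⟨g, hg⟩ := WithTop.ne_top_iff_exists.1 (mt (s.nuVal_eq_top_iff i).1 hf0)
  exact ⟨g, fun μ h => by rw [h.val_of_stable hi, ← hg, WithTop.map_coe]⟩

end PCSeq

/-! ### Uniqueness of the supremum through a minimal unstable polynomial. -/

namespace PCSeq

variable {K : Type u₁} [Field K] {Γ : Type u₂} [AddCommGroup Γ] [LinearOrder Γ]
  [IsOrderedAddMonoid Γ] {v : AddValuation K (WithTop Γ)} (s : PCSeq.{u₁, u₂, u₃} v)

/-- `F` has minimal degree among the polynomials that are not stable. -/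
structure IsMinUnstable (F : K[X]) : Prop where
  not_stable : ¬ s.Stable F
  stable_of_lt : ∀ g : K[X], g.natDegree < F.natDegree → s.Stable g

/-- The values `ν_i (F)` are bounded by an element of `Γ`. -/
def BddBy (F : K[X]) : Prop := ∃ g : Γ, ∀ i, s.nuVal i F ≤ g

theorem exists_isMinUnstable {f : K[X]} (hf : ¬ s.Stable f) : ∃ F, s.IsMinUnstable F := by
  induction hd : f.natDegree using Nat.strong_induction_on generalizing f with
  | _ d ih =>
    by_contra! hcon
    exact hcon f ⟨hf, fun g hg => by_contra fun h =>
      let ⟨F, hF⟩ := ih _ (hd ▸ hg) h rfl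
      hcon F hF⟩

variable {s} {F : K[X]} {μ : ExtVal v}

theorem IsMinUnstable.natDegree_pos (hF : s.IsMinUnstable F) : 0 < F.natDegree := by
  by_contra! h0
  obtain ⟨c, rfl⟩ := natDegree_eq_zero.1 (le_antisymm h0 zero_le)
  exact hF.not_stable ⟨Classical.arbitrary _, fun j _ => by rw [nuVal_C, nuVal_C]⟩

theorem IsMinUnstable.ne_zero (hF : s.IsMinUnstable F) : F ≠ 0 :=
  fun h => hF.not_stable (h ▸ s.stable_zero)

theorem IsMinUnstable.stable_mod (hF : s.IsMinUnstable F) (f : K[X]) : s.Stable (f % F) :=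
  hF.stable_of_lt _ (natDegree_mod_lt f hF.natDegree_pos.ne')

/-- Equality would force some `n ν_i(F)` to reach `g` while no `n ν_j(F)` exceeds it, yet these
values keep growing strictly. -/
theorem IsLim.nsmul_val_ne (h : s.IsLim μ) (hF : ¬ s.Stable F) {n : ℕ} (hn : n ≠ 0) (g : Γ) :
    n • μ.val F ≠ ((μ.emb g : μ.Λ) : WithTop μ.Λ) := by
  intro heq
  obtain ⟨i, hi⟩ := (h.le_iff F g n hn).1 heq.ge
  obtain ⟨j, -, hj⟩ := s.not_stable hF i
  have h1 : n • s.nuVal j F ≤ n • s.nuVal i F := ((h.ge_iff F g n hn).1 heq.le j).trans hi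
  exact absurd ((QuasiCut.nsmul_le_nsmul_iff hn).1 h1) (not_le.2 hj)

theorem IsLim.exists_val_eq_coe (h : s.IsLim μ) (hb : s.BddBy F) :
    ∃ ρ : μ.Λ, μ.val F = (ρ : WithTop μ.Λ) := by
  obtain ⟨g, hg⟩ := hb
  have h1 := (h.ge_iff F g 1 one_ne_zero).2 (by simpa using hg)
  rw [one_nsmul] at h1
  obtain ⟨ρ, hρ⟩ := WithTop.ne_top_iff_exists.1 (h1.trans_lt (WithTop.coe_lt_top _)).ne
  exact ⟨ρ, hρ.symm⟩

theorem IsLim.val_eq_top (h : s.IsLim μ) (hb : ¬ s.BddBy F) : μ.val F = ⊤ := by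
  refine h.eq_top F fun g => ?_
  by_contra! hcon
  exact hb ⟨g, hcon⟩

/-- If the values `ν_i (F)` are bounded, then `f` has the value `g + j μ (F)` with the same `g` and
`j` for all limits `μ`. -/
theorem IsMinUnstable.exists_val_eq (hF : s.IsMinUnstable F) (hb : s.BddBy F) {f : K[X]}
    (hf : f ≠ 0) : ∃ (g : Γ) (j : ℕ), ∀ μ : ExtVal v, s.IsLim μ →
      μ.val f = ((μ.emb g : μ.Λ) : WithTop μ.Λ) + j • μ.val F := by
  induction hd : f.natDegree using Nat.strong_induction_on generalizing f with
  | _ d ih =>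
    by_cases hlt : f.natDegree < F.natDegree
    · obtain ⟨g, hg⟩ := (hF.stable_of_lt f hlt).exists_val_eq hf
      exact ⟨g, 0, fun μ h => by rw [hg μ h, zero_nsmul, add_zero]⟩
    have hq : f / F ≠ 0 := by
      rw [Ne, Polynomial.div_eq_zero_iff hF.ne_zero]
      exact fun h => hlt (natDegree_lt_natDegree hf h)
    have hqd : (f / F).natDegree < d := by
      rw [← hd]
      exact natDegree_lt_natDegree hq
        (degree_div_lt hf (natDegree_pos_iff_degree_pos.1 hF.natDegree_pos))
    obtain ⟨g, j, hgj⟩ := ih _ hqd hq rfl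
    have hmul : ∀ μ : ExtVal v, s.IsLim μ → μ.val (F * (f / F)) =
        ((μ.emb g : μ.Λ) : WithTop μ.Λ) + (j + 1) • μ.val F := by
      intro μ h
      rw [μ.val.map_mul, hgj μ h, succ_nsmul]
      abel
    have hdm : F * (f / F) + f % F = f := EuclideanDomain.div_add_mod f F
    by_cases hr : f % F = 0
    · rw [hr, add_zero] at hdm
      exact ⟨g, j + 1, fun μ h => by rw [← hmul μ h, hdm]⟩
    obtain ⟨b, hbr⟩ := (hF.stable_mod f).exists_val_eq hr
    -- The remainder has its value in `Γ`, while `F * (f / F)` involves a positive multiple of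
    -- `μ(F)`. The two never tie, so `μ(f)` is the smaller one.
    have key : ∀ μ : ExtVal v, s.IsLim μ → (μ.val (f % F) ≠ μ.val (F * (f / F))) ∧
        (μ.val (f % F) ≤ μ.val (F * (f / F)) ↔
          ((μ.emb (b - g) : μ.Λ) : WithTop μ.Λ) ≤ (j + 1) • μ.val F) := by
      intro μ h
      have hne := h.nsmul_val_ne hF.not_stable j.succ_ne_zero (b - g)
      obtain ⟨ρ, hρ⟩ := h.exists_val_eq_coe hb
      rw [hbr μ h, hmul μ h]
      rw [hρ] at hne ⊢
      norm_cast at hne ⊢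
      rw [map_sub] at hne ⊢
      refine ⟨fun h' => hne ?_, sub_le_iff_le_add'.symm⟩
      rw [h', add_sub_cancel_left]
    -- Which of the two is smaller is decided by the `ν_i` alone, hence in the same way for all
    -- limits.
    by_cases hex : ∃ i : s.Istar, ((b - g : Γ) : WithTop Γ) ≤ (j + 1) • s.nuVal i F
    · refine ⟨b, 0, fun μ h => ?_⟩
      have h1 := (key μ h).2.2 ((h.le_iff F _ _ j.succ_ne_zero).2 hex)
      rw [← hdm, μ.val.map_add_eq_of_lt_right (lt_of_le_of_ne h1 (key μ h).1), hbr μ h,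
        zero_nsmul, add_zero]
    · refine ⟨g, j + 1, fun μ h => ?_⟩
      have h1 := mt (key μ h).2.1 (mt (h.le_iff F _ _ j.succ_ne_zero).1 hex)
      rw [← hmul μ h]
      conv_lhs => rw [← hdm]
      exact μ.val.map_add_eq_of_lt_left (not_le.1 h1)

/-- Cancelling the smaller multiple of `μ(F)` leaves either an inequality in `Γ` or one between an
element of `Γ` and a positive multiple of `μ(F)`, which `IsLim` expresses through the `ν_i`. -/
theorem IsLim.le_transfer {μ' : ExtVal v} (h : s.IsLim μ) (h' : s.IsLim μ') (hb : s.BddBy F)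
    {g b : Γ} {j l : ℕ}
    (hle : ((μ.emb g : μ.Λ) : WithTop μ.Λ) + j • μ.val F ≤
      ((μ.emb b : μ.Λ) : WithTop μ.Λ) + l • μ.val F) :
    ((μ'.emb g : μ'.Λ) : WithTop μ'.Λ) + j • μ'.val F ≤
      ((μ'.emb b : μ'.Λ) : WithTop μ'.Λ) + l • μ'.val F := by
  obtain ⟨ρ, hρ⟩ := h.exists_val_eq_coe hb
  obtain ⟨ρ', hρ'⟩ := h'.exists_val_eq_coe hb
  have hlei : ∀ (a : Γ) (n : ℕ), n ≠ 0 → (μ.emb a ≤ n • ρ ↔ μ'.emb a ≤ n • ρ') := by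
    intro a n hn
    have h1 := (h.le_iff F a n hn).trans (h'.le_iff F a n hn).symm
    rw [hρ, hρ'] at h1
    exact_mod_cast h1
  have hgei : ∀ (a : Γ) (n : ℕ), n ≠ 0 → (n • ρ ≤ μ.emb a ↔ n • ρ' ≤ μ'.emb a) := by
    intro a n hn
    have h1 := (h.ge_iff F a n hn).trans (h'.ge_iff F a n hn).symm
    rw [hρ, hρ'] at h1
    exact_mod_cast h1
  rw [hρ] at hle
  rw [hρ']
  norm_cast at hle ⊢
  rcases lt_trichotomy j l with hjl | rfl | hjl
  · obtain ⟨n, rfl⟩ := Nat.exists_eq_add_of_lt hjl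
    rw [add_assoc, add_nsmul, add_left_comm, add_comm, add_le_add_iff_left, ← sub_le_iff_le_add',
      ← map_sub] at hle ⊢
    exact (hlei _ _ n.succ_ne_zero).1 hle
  · rw [add_le_add_iff_right, μ.emb_strictMono.le_iff_le] at hle
    rwa [add_le_add_iff_right, μ'.emb_strictMono.le_iff_le]
  · obtain ⟨n, rfl⟩ := Nat.exists_eq_add_of_lt hjl
    rw [add_assoc, add_nsmul, add_left_comm, add_comm (_ : _) (l • _), add_le_add_iff_left,
      ← le_sub_iff_add_le', ← map_sub] at hle ⊢
    exact (hgei _ _ n.succ_ne_zero).1 hle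

theorem IsLim.val_le_transfer {μ' : ExtVal v} (h : s.IsLim μ) (h' : s.IsLim μ') {f g : K[X]}
    (hle : μ.val f ≤ μ.val g) : μ'.val f ≤ μ'.val g := by
  have hstab : ∀ f g : K[X], s.Stable f → s.Stable g → μ.val f ≤ μ.val g →
      μ'.val f ≤ μ'.val g := by
    rintro f g ⟨i, hi⟩ ⟨j, hj⟩ hle
    rw [h.val_of_stable hi, h.val_of_stable hj, map_emb_le_map_emb] at hle
    rwa [h'.val_of_stable hi, h'.val_of_stable hj, map_emb_le_map_emb]
  by_cases hall : ∀ f, s.Stable f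
  · exact hstab f g (hall f) (hall g) hle
  push Not at hall
  obtain ⟨f₀, hf₀⟩ := hall
  obtain ⟨F, hF⟩ := s.exists_isMinUnstable hf₀
  by_cases hb : s.BddBy F
  · by_cases hg : g = 0
    · rw [hg, AddValuation.map_zero]
      exact le_top
    obtain ⟨c, l, hcl⟩ := hF.exists_val_eq hb hg
    have hf : f ≠ 0 := by
      rintro rfl
      obtain ⟨ρ, hρ⟩ := h.exists_val_eq_coe hb
      rw [AddValuation.map_zero, top_le_iff, hcl μ h, hρ] at hle
      norm_cast at hle
    obtain ⟨b, j, hbj⟩ := hF.exists_val_eq hb hf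
    rw [hcl μ h, hbj μ h] at hle
    rw [hcl μ' h', hbj μ' h']
    exact h.le_transfer h' hb hle
  -- Here `F` lies in the support, so values depend only on remainders, which are stable.
  · have hmod : ∀ ν : ExtVal v, s.IsLim ν → ∀ f : K[X], ν.val f = ν.val (f % F) := by
      intro ν hν f
      conv_lhs => rw [← EuclideanDomain.div_add_mod f F, add_comm]
      refine ν.val.map_add_supp _ ((ν.val.mem_supp_iff _).2 ?_)
      rw [ν.val.map_mul, hν.val_eq_top hb, top_add]
    rw [hmod μ h f, hmod μ h g] at hle
    rw [hmod μ' h' f, hmod μ' h' g]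
    exact hstab _ _ (hF.stable_mod f) (hF.stable_mod g) hle

theorem IsLim.isEquiv {μ' : ExtVal v} (h : s.IsLim μ) (h' : s.IsLim μ') :
    μ.val.IsEquiv μ'.val :=
  fun _ _ => ⟨fun hle => h.val_le_transfer h' hle, fun hle => h'.val_le_transfer h hle⟩

theorem _root_.Psi_eq_iff (hv : Function.Surjective v) (s : PCSeq.{u₁, u₂, u₃} v) (μ : ExtVal v) :
    Psi v s = ⟦μ⟧ ↔ μ.IsSup s := by
  have : Nonempty (ValClass v) := ⟨⟦default⟧⟩
  obtain ⟨μ₀, h₀, heq⟩ : ∃ μ : ExtVal v, μ.IsSup s ∧ Psi v s = ⟦μ⟧ :=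
    Classical.epsilon_spec (p := fun x => ∃ μ : ExtVal v, μ.IsSup s ∧ x = ⟦μ⟧)
      ⟨⟦s.limVal⟧, s.limVal, s.isLim_limVal.isSup, rfl⟩
  rw [heq, Quotient.eq]
  exact ⟨fun h => (h₀.isLim.of_equiv hv h).isSup, fun h => h₀.isLim.isEquiv h.isLim⟩

end PCSeq

/-! ### Support, value group and the valuation on `K(x)`. -/

namespace ExtVal

variable {K : Type u₁} [Field K] {Γ : Type u₂} [AddCommGroup Γ] [LinearOrder Γ]
  [IsOrderedAddMonoid Γ] {v : AddValuation K (WithTop Γ)} {μ : ExtVal v}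

theorem supp_eq_bot (h : ∀ f : K[X], f ≠ 0 → μ.val f ≠ ⊤) : μ.val.supp = ⊥ :=
  (Submodule.eq_bot_iff _).2 fun f hf => by_contra fun h0 => h f h0 ((μ.val.mem_supp_iff f).1 hf)

theorem fracVal_algebraMap (h : μ.val.supp = ⊥) (f : K[X]) :
    μ.fracVal h (algebraMap K[X] (RatFunc K) f) =
      Multiplicative.ofAdd (OrderDual.toDual (μ.val f)) :=
  Valuation.extendToLocalization_apply_map_apply _ _ _ _

theorem fracVal_div_le_one (h : μ.val.supp = ⊥) (f : K[X]) {g : K[X]} (hg : g ≠ 0) :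
    μ.fracVal h (algebraMap K[X] (RatFunc K) f / algebraMap K[X] (RatFunc K) g) ≤ 1 ↔
      μ.val g ≤ μ.val f := by
  have hg' : 0 < μ.fracVal h (algebraMap K[X] (RatFunc K) g) := by
    rw [zero_lt_iff, Valuation.ne_zero_iff]
    exact RatFunc.algebraMap_ne_zero hg
  rw [map_div₀, div_le_one₀ hg', fracVal_algebraMap, fracVal_algebraMap]
  rfl

theorem fracVal_div_lt_one (h : μ.val.supp = ⊥) (f : K[X]) {g : K[X]} (hg : g ≠ 0) :
    μ.fracVal h (algebraMap K[X] (RatFunc K) f / algebraMap K[X] (RatFunc K) g) < 1 ↔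
      μ.val g < μ.val f := by
  have hg' : 0 < μ.fracVal h (algebraMap K[X] (RatFunc K) g) := by
    rw [zero_lt_iff, Valuation.ne_zero_iff]
    exact RatFunc.algebraMap_ne_zero hg
  rw [map_div₀, div_lt_one₀ hg', fracVal_algebraMap, fracVal_algebraMap]
  rfl

theorem fracVal_algebraMap_lt_one (h : μ.val.supp = ⊥) (f : K[X]) :
    μ.fracVal h (algebraMap K[X] (RatFunc K) f) < 1 ↔ 0 < μ.val f := by
  have := fracVal_div_lt_one h f one_ne_zero
  rwa [map_one, div_one, AddValuation.map_one] at this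

theorem fracVal_algebraMap_le_one (h : μ.val.supp = ⊥) (f : K[X]) :
    μ.fracVal h (algebraMap K[X] (RatFunc K) f) ≤ 1 ↔ 0 ≤ μ.val f := by
  have := fracVal_div_le_one h f one_ne_zero
  rwa [map_one, div_one, AddValuation.map_one] at this

theorem torsionValueGroup (h : ∀ f : K[X], f ≠ 0 → ∃ g : Γ, μ.val f = ((μ.emb g : μ.Λ) :
    WithTop μ.Λ)) : μ.TorsionValueGroup := by
  have hle : μ.valueGroup ≤ μ.emb.range := by
    rw [valueGroup, AddSubgroup.closure_le]
    rintro l ⟨f, hf⟩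
    have hf0 : f ≠ 0 := by
      rintro rfl
      rw [AddValuation.map_zero] at hf
      exact WithTop.coe_ne_top hf.symm
    obtain ⟨g, hg⟩ := h f hf0
    exact ⟨g, WithTop.coe_inj.1 (hg.symm.trans hf)⟩
  intro x
  obtain ⟨y, rfl⟩ := QuotientAddGroup.mk_surjective x
  rw [(QuotientAddGroup.eq_zero_iff y).2 (AddSubgroup.mem_addSubgroupOf.2 (hle y.2))]
  exact IsOfFinAddOrder.zero

theorem not_torsionValueGroup {F : K[X]} {ρ : μ.Λ} (hρ : μ.val F = (ρ : WithTop μ.Λ))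
    (h : ∀ (n : ℕ) (g : Γ), n ≠ 0 → n • ρ ≠ μ.emb g) : ¬ μ.TorsionValueGroup := by
  intro htor
  have hmem : ρ ∈ μ.valueGroup := AddSubgroup.subset_closure ⟨F, hρ⟩
  obtain ⟨n, hn, hn'⟩ := isOfFinAddOrder_iff_nsmul_eq_zero.1 (htor ((⟨ρ, hmem⟩ : μ.valueGroup) :
    μ.valueGroup ⧸ (μ.emb.range.addSubgroupOf μ.valueGroup)))
  rw [← QuotientAddGroup.mk_nsmul, QuotientAddGroup.eq_zero_iff,
    AddSubgroup.mem_addSubgroupOf] at hn'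
  obtain ⟨g, hg⟩ := hn'
  exact h n g hn.ne' hg.symm

end ExtVal

/-! ### The type of the limit when `I*` has no last element. -/

namespace PCSeq

variable {K : Type u₁} [Field K] {Γ : Type u₂} [AddCommGroup Γ] [LinearOrder Γ]
  [IsOrderedAddMonoid Γ] {v : AddValuation K (WithTop Γ)} {s : PCSeq.{u₁, u₂, u₃} v}
  {F : K[X]} {μ : ExtVal v}

theorem IsMinNotFixed.isMinUnstable (hF : s.IsMinNotFixed F) (h : ¬ s.IstarHasMax) :
    s.IsMinUnstable F :=
  ⟨fun hst => hF.2.1 (hst.fixes h), fun _ hg => stable_of_forall_fixes h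
    (fun f hf => by_contra fun hns => absurd hf (not_lt.2 (hF.2.2 f hns))) hg⟩

theorem coe_mk_le_iff {g : Γ} {n : ℕ+} {x : WithTop Γ} :
    ((DivisibleHull.mk g n : DivisibleHull Γ) : WithTop (DivisibleHull Γ)) ≤
      x.map (DivisibleHull.coeAddMonoidHom Γ) ↔ (g : WithTop Γ) ≤ (n : ℕ) • x := by
  cases x with
  | top =>
    rw [WithTop.map_top, ← PNat.natPred_add_one, succ_nsmul, add_top]
    exact iff_of_true le_top le_top
  | coe x =>
    rw [WithTop.map_coe, ← WithTop.coe_nsmul, WithTop.coe_le_coe, WithTop.coe_le_coe]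
    change DivisibleHull.mk g n ≤ DivisibleHull.mk x 1 ↔ _
    rw [DivisibleHull.mk_le_mk, PNat.one_coe, one_nsmul]

theorem cut_ne_top_iff (hF : ¬ s.Stable F) : s.cut F ≠ ⊤ ↔ s.BddBy F := by
  constructor
  · intro h
    by_contra hb
    have hl : (s.cut F).left = Set.univ := by
      refine Set.eq_univ_of_forall fun q => ?_
      induction q with
      | mk g n =>
        -- Aiming at `|g|` makes `ν_i(F)` nonnegative, so that multiplying it by `n` does not
        -- decrease it.
        have hex : ∃ i, ((|g| : Γ) : WithTop Γ) ≤ s.nuVal i F := by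
          by_contra! hcon
          exact hb ⟨|g|, fun i => (hcon i).le⟩
        obtain ⟨i, hi⟩ := hex
        refine ⟨i, i.2, coe_mk_le_iff.2 ?_⟩
        have h1 : (g : WithTop Γ) ≤ (|g| : Γ) := WithTop.coe_le_coe.2 (le_abs_self g)
        have h0 : (0 : WithTop Γ) ≤ s.nuVal i F :=
          le_trans (WithTop.coe_le_coe.2 (abs_nonneg g)) hi
        exact (h1.trans hi).trans (le_self_nsmul h0 n.ne_zero)
    exact h (QuasiCut.ext hl (congrArg compl hl |>.trans Set.compl_univ))
  · rintro ⟨g, hg⟩ htop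
    have hmem : DivisibleHull.mk g 1 ∈ (s.cut F).left := by
      rw [htop]
      exact Set.mem_univ _
    obtain ⟨i, hi, hle⟩ := hmem
    rw [coe_mk_le_iff, PNat.one_coe, one_nsmul] at hle
    obtain ⟨j, -, hj⟩ := s.not_stable hF ⟨i, hi⟩
    exact absurd ((hg j).trans hle) (not_le.2 hj)

theorem IsLim.isValueTranscendental (h : s.IsLim μ) (hF : s.IsMinUnstable F) (hb : s.BddBy F) :
    μ.IsValueTranscendental := by
  obtain ⟨ρ, hρ⟩ := h.exists_val_eq_coe hb
  refine ⟨ExtVal.supp_eq_bot fun f hf => ?_, ExtVal.not_torsionValueGroup hρ fun n g hn heq => ?_⟩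
  · obtain ⟨g, j, hgj⟩ := hF.exists_val_eq hb hf
    rw [hgj μ h, hρ, ← WithTop.coe_nsmul, ← WithTop.coe_add]
    exact WithTop.coe_ne_top
  · refine h.nsmul_val_ne hF.not_stable hn g ?_
    rw [hρ, ← WithTop.coe_nsmul, heq]

theorem IsLim.hasNontrivialSupport (h : s.IsLim μ) (hF : s.IsMinUnstable F) (hb : ¬ s.BddBy F) :
    μ.HasNontrivialSupport := by
  have hFtop : μ.val F = ⊤ := h.val_eq_top hb
  have hsupp : μ.val.supp = Ideal.span {F} := by
    refine le_antisymm (fun f hf => ?_) ?_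
    · rw [AddValuation.mem_supp_iff] at hf
      rw [Ideal.mem_span_singleton, ← EuclideanDomain.mod_eq_zero]
      by_contra hr
      -- A nonzero remainder is stable and so has finite value, although it shares the value `∞` of
      -- `f`.
      obtain ⟨g, hg⟩ := (hF.stable_mod f).exists_val_eq hr
      have h1 : μ.val f = μ.val (f % F) := by
        conv_lhs => rw [← EuclideanDomain.div_add_mod f F, add_comm]
        refine μ.val.map_add_supp _ ((μ.val.mem_supp_iff _).2 ?_)
        rw [μ.val.map_mul, hFtop, top_add]
      rw [hf, hg μ h] at h1
      exact WithTop.coe_ne_top h1.symm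
    · rw [Ideal.span_singleton_le_iff_mem, AddValuation.mem_supp_iff, hFtop]
  have hprime : (Ideal.span {F}).IsPrime := by
    rw [← hsupp]
    exact inferInstanceAs (Valuation.supp μ.val.toValuation).IsPrime
  exact ⟨F, hF.ne_zero, ((Ideal.span_singleton_prime hF.ne_zero).1 hprime).irreducible, hsupp⟩

theorem IsLim.supp_eq_bot_of_stable (h : s.IsLim μ) (hst : ∀ f, s.Stable f) :
    μ.val.supp = ⊥ := by
  refine ExtVal.supp_eq_bot fun f hf => ?_
  obtain ⟨g, hg⟩ := (hst f).exists_val_eq hf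
  rw [hg μ h]
  exact WithTop.coe_ne_top

theorem IsLim.exists_val_lt_val_sub_eval (h : s.IsLim μ) (hmax : ¬ s.IstarHasMax) {f : K[X]}
    (hf : s.Stable f) (hf0 : f ≠ 0) : ∃ i : s.Istar, ∀ j : s.Istar, i ≤ j →
      μ.val f = μ.val (C (f.eval (s.a j))) ∧ μ.val f < μ.val (f - C (f.eval (s.a j))) := by
  obtain ⟨i, hi⟩ := hf
  obtain ⟨k, hk⟩ := s.exists_gt hmax i
  refine ⟨k, fun j hj => ?_⟩
  have hij := hk.trans_le hj
  have hlt : μ.val f < μ.val (f - C (f.eval (s.a j))) := by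
    rw [h.val_of_stable hi]
    have hle := h.isSup.1 j j.2 (f - C (f.eval (s.a j)))
    refine lt_of_lt_of_le ?_ hle
    have h1 := s.nuVal_lt_nuVal_sub_eval hij hf0
    exact lt_of_le_not_ge ((map_emb_le_map_emb μ).2 h1.le) fun h2 =>
      absurd ((map_emb_le_map_emb μ).1 h2) (not_le.2 h1)
  refine ⟨?_, hlt⟩
  rw [AddValuation.map_sub_swap] at hlt
  exact (μ.val.map_eq_of_lt_sub hlt).symm

theorem IsLim.isValuationAlgebraic (h : s.IsLim μ) (hmax : ¬ s.IstarHasMax)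
    (hst : ∀ f, s.Stable f) : μ.IsValuationAlgebraic := by
  have hsupp := h.supp_eq_bot_of_stable hst
  refine ⟨hsupp, ExtVal.torsionValueGroup fun f hf =>
    let ⟨g, hg⟩ := (hst f).exists_val_eq hf
    ⟨g, hg μ h⟩, ?_⟩
  -- In fact the residue field does not grow: a unit `f / g` has the residue of `f(a_j) / g(a_j)`
  -- for large `j`.
  suffices hsurj : Function.Surjective (algebraMap (resField v) (μ.residueField hsupp)) by
    refine ⟨fun x => ?_⟩
    obtain ⟨y, rfl⟩ := hsurj x
    exact isAlgebraic_algebraMap y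
  intro x
  obtain ⟨r, rfl⟩ := IsLocalRing.residue_surjective x
  by_cases hr : IsLocalRing.residue _ r = 0
  · exact ⟨0, by rw [hr, map_zero]⟩
  obtain ⟨r, hr1⟩ := r
  obtain ⟨f, g, hg, rfl⟩ := IsFractionRing.div_surjective K[X] r
  have hg0 : g ≠ 0 := nonZeroDivisors.ne_zero hg
  have hgf : μ.val g ≤ μ.val f := (ExtVal.fracVal_div_le_one hsupp f hg0).1 hr1
  have hfg : μ.val g = μ.val f := by
    refine le_antisymm hgf (not_lt.1 fun hlt => hr ?_)
    rw [IsLocalRing.residue_eq_zero_iff, Valuation.mem_maximalIdeal_iff]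
    exact (ExtVal.fracVal_div_lt_one hsupp f hg0).2 hlt
  have hgtop : μ.val g ≠ ⊤ := fun h0 => hg0 (by
    have : g ∈ μ.val.supp := (μ.val.mem_supp_iff g).2 h0
    rwa [hsupp, Submodule.mem_bot] at this)
  have hf0 : f ≠ 0 := by
    rintro rfl
    rw [AddValuation.map_zero] at hfg
    exact hgtop hfg
  obtain ⟨i₁, hi₁⟩ := h.exists_val_lt_val_sub_eval hmax (hst f) hf0
  obtain ⟨i₂, hi₂⟩ := h.exists_val_lt_val_sub_eval hmax (hst g) hg0
  obtain ⟨hf1, hf2⟩ := hi₁ _ (le_max_left i₁ i₂)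
  obtain ⟨hg1, hg2⟩ := hi₂ _ (le_max_right i₁ i₂)
  set a := f.eval (s.a (max i₁ i₂ : s.Istar))
  set b := g.eval (s.a (max i₁ i₂ : s.Istar))
  have hb0 : b ≠ 0 := by
    intro h0
    rw [h0, C_0, AddValuation.map_zero] at hg1
    exact hgtop hg1
  have hvab : v a = v b := by
    refine WithTop.map_injective μ.emb_strictMono.injective ?_
    rw [← μ.val_C, ← μ.val_C, ← hf1, ← hg1, hfg]
  have hab : a / b ∈ v.toValuation.valuationSubring := by
    rw [Valuation.mem_valuationSubring_iff, map_div₀]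
    have : v.toValuation a = v.toValuation b := hvab
    rw [this]
    exact div_self_le_one _
  refine ⟨IsLocalRing.residue _ ⟨a / b, hab⟩, ?_⟩
  rw [Valuation.HasExtension.algebraMap_residue_eq_residue_algebraMap, eq_comm, ← sub_eq_zero,
    ← map_sub, IsLocalRing.residue_eq_zero_iff, Valuation.mem_maximalIdeal_iff]
  change μ.fracVal hsupp (algebraMap K[X] (RatFunc K) f / algebraMap K[X] (RatFunc K) g -
    algebraMap K (RatFunc K) (a / b)) < 1
  have hCb : (C b : K[X]) ≠ 0 := by simpa using hb0
  have heq : algebraMap K[X] (RatFunc K) f / algebraMap K[X] (RatFunc K) g -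
      algebraMap K (RatFunc K) (a / b) = algebraMap K[X] (RatFunc K)
        ((f - C a) * C b - C a * (g - C b)) / algebraMap K[X] (RatFunc K) (g * C b) := by
    have hC : ∀ c : K, algebraMap K[X] (RatFunc K) (C c) = algebraMap K (RatFunc K) c :=
      fun c => (IsScalarTower.algebraMap_apply K K[X] (RatFunc K) c).symm
    have h1 : algebraMap K[X] (RatFunc K) g ≠ 0 := RatFunc.algebraMap_ne_zero hg0
    have h2 : algebraMap K (RatFunc K) b ≠ 0 := by
      rw [← hC]
      exact RatFunc.algebraMap_ne_zero hCb
    simp only [map_sub, map_mul, map_div₀, hC]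
    field_simp
    ring
  rw [heq, ExtVal.fracVal_div_lt_one hsupp _ (mul_ne_zero hg0 hCb), μ.val.map_mul, ← hg1]
  have hbtop := hgtop
  rw [hg1] at hbtop
  rw [AddValuation.map_sub_swap]
  -- In each product of the numerator one factor is a difference `f - f(a_j)` or `g - g(a_j)`, whose
  -- value exceeds the common value of `f` and `g`.
  refine lt_of_lt_of_le (lt_min ?_ ?_) (μ.val.map_sub _ _)
  · rw [μ.val.map_mul, ← hf1, hfg]
    rw [hfg] at hgtop hg2
    exact WithTop.add_lt_add_of_le_of_lt hgtop le_rfl hg2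
  · rw [μ.val.map_mul, ← hg1, hfg]
    rw [hfg] at hgtop
    exact WithTop.add_lt_add_of_lt_of_le hgtop hf2 le_rfl

end PCSeq

/-! ### The type of the limit when `I*` has a last element. -/

namespace PCSeq

variable {K : Type u₁} [Field K] {Γ : Type u₂} [AddCommGroup Γ] [LinearOrder Γ]
  [IsOrderedAddMonoid Γ] {v : AddValuation K (WithTop Γ)} {s : PCSeq.{u₁, u₂, u₃} v}
  {μ : ExtVal v}

/-- With `v(d) = γ_m`, the valuation `ν_m` is the Gauss valuation in `y = (x - a_m) / d`, so the
residue of `y` satisfies no nontrivial polynomial relation. -/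
theorem IsLim.isResidueTranscendental (hv : Function.Surjective v) (h : s.IsLim μ)
    (hmax : s.IstarHasMax) : μ.IsResidueTranscendental := by
  have hsupp := h.supp_eq_bot_of_stable (stable_of_istarHasMax hmax)
  obtain ⟨m, hm, hm'⟩ := hmax
  have hμ : ∀ f, μ.val f = (s.nuVal ⟨m, hm⟩ f).map μ.emb := fun f =>
    h.val_of_stable (i := ⟨m, hm⟩) fun j hj => by rw [le_antisymm hj (hm' j.2)]
  obtain ⟨d, hd⟩ := hv (s.gam m)
  have hd0 : d ≠ 0 := v.ne_top_iff.1 (hd ▸ s.gam_ne_top hm)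
  obtain ⟨γ, hγ⟩ := WithTop.ne_top_iff_exists.1 (s.gam_ne_top hm)
  set y : K[X] := C d⁻¹ * (X - C (s.a m)) with hy
  have hinv : v d⁻¹ + s.gam m = 0 := by
    rw [← hd, ← v.map_mul, inv_mul_cancel₀ hd0, v.map_one]
  have hy0 : 0 ≤ μ.val y := by
    rw [hμ, hy, AddValuation.map_mul, nuVal_C]
    have : s.nuVal ⟨m, hm⟩ (X - C (s.a m)) = s.gam m := s.nuVal_X_sub_C ⟨m, hm⟩
    rw [this, hinv, WithTop.map_zero, _root_.map_zero, WithTop.coe_zero]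
  let y' : (μ.fracVal hsupp).valuationSubring :=
    ⟨algebraMap K[X] (RatFunc K) y, (ExtVal.fracVal_algebraMap_le_one hsupp y).2 hy0⟩
  refine ⟨hsupp, ⟨IsLocalRing.residue _ y', ?_⟩⟩
  rw [transcendental_iff]
  intro P hP
  obtain ⟨Q, rfl⟩ := Polynomial.map_surjective _
    (IsLocalRing.residue_surjective (R := v.toValuation.valuationSubring)) P
  have h1 : IsLocalRing.residue _ (aeval y' Q) = 0 := by
    rw [← hP, aeval_def, aeval_def, eval₂_map, Polynomial.hom_eval₂]
    rfl
  rw [IsLocalRing.residue_eq_zero_iff, Valuation.mem_maximalIdeal_iff] at h1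
  have h2 : ((aeval y' Q : (μ.fracVal hsupp).valuationSubring) : RatFunc K) =
      algebraMap K[X] (RatFunc K) ((Q.map (algebraMap _ K)).comp y) := by
    have e1 : ((aeval y' Q : (μ.fracVal hsupp).valuationSubring) : RatFunc K) =
        (μ.fracVal hsupp).valuationSubring.subtype (aeval y' Q) := rfl
    rw [e1, aeval_def, Polynomial.hom_eval₂, comp, eval₂_map, Polynomial.hom_eval₂]
    congr 1
  rw [h2, ExtVal.fracVal_algebraMap_lt_one, hμ] at h1
  have h3 : 0 < s.nuVal ⟨m, hm⟩ ((Q.map (algebraMap _ K)).comp y) := by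
    by_contra! hcon
    refine absurd ((map_emb_le_map_emb μ).2 hcon) (not_le.2 ?_)
    rwa [WithTop.map_zero, _root_.map_zero, WithTop.coe_zero]
  ext k
  rw [coeff_map, coeff_zero, IsLocalRing.residue_eq_zero_iff, Valuation.mem_maximalIdeal_iff]
  change 0 < v (Q.coeff k : K)
  refine h3.trans_le ?_
  -- The Taylor coefficient of `Q(y)` at `a_m` is `Q_k d⁻ᵏ`; the value of `d⁻ᵏ` cancels `k γ_m`,
  -- leaving `v(Q_k)`.
  have h4 := monomialVal.le_coeff (v := v) (a := s.a m) (γ := s.gam m)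
    ((Q.map (algebraMap _ K)).comp y) k
  have h5 : taylor (s.a m) ((Q.map (algebraMap _ K)).comp y) =
      (Q.map (algebraMap _ K)).comp (C d⁻¹ * X) := by
    rw [taylor_apply, comp_assoc, hy]
    simp
  rw [h5, comp_C_mul_X_coeff, coeff_map, v.map_mul, v.map_pow, add_assoc, ← nsmul_add, hinv,
    nsmul_zero, add_zero] at h4
  exact h4

end PCSeq

end

theorem mainTheorem2 {K : Type u₁} [Field K] {Γ : Type u₂} [AddCommGroup Γ] [LinearOrder Γ]
    [IsOrderedAddMonoid Γ] (v : AddValuation K (WithTop Γ)) (hv : Function.Surjective v) :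
    (∀ (s : PCSeq.{u₁, u₂, u₃} v) (μ : ExtVal v), Psi v s = ⟦μ⟧ ↔ μ.IsSup s) ∧
    Psi.{u₁, u₂, u₃} v '' Srt v ⊆ Vrt v ∧
    Psi.{u₁, u₂, u₃} v '' Sal v ⊆ Val v ∧
    Psi.{u₁, u₂, u₃} v '' Svt v ⊆ Vvt v ∧
    Psi.{u₁, u₂, u₃} v '' Snt v ⊆ Vnt v := by
  have hlim : ∀ (s : PCSeq.{u₁, u₂, u₃} v) (μ : ExtVal v), ⟦μ⟧ = Psi v s → s.IsLim μ :=
    fun s μ h => ((Psi_eq_iff hv s μ).1 h.symm).isLim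
  refine ⟨Psi_eq_iff hv, ?_, ?_, ?_, ?_⟩
  · rintro _ ⟨s, hs, rfl⟩ μ hμ
    exact (hlim s μ hμ).isResidueTranscendental hv hs
  · rintro _ ⟨s, ⟨hmax, hfix⟩, rfl⟩ μ hμ
    exact (hlim s μ hμ).isValuationAlgebraic hmax fun f =>
      PCSeq.stable_of_forall_fixes hmax (fun g _ => hfix g) f.natDegree.lt_succ_self
  · rintro _ ⟨s, ⟨⟨hmax, -⟩, F, hF, hcut⟩, rfl⟩ μ hμ
    have hF' := hF.isMinUnstable hmax
    exact (hlim s μ hμ).isValueTranscendental hF' ((PCSeq.cut_ne_top_iff hF'.not_stable).1 hcut)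
  · rintro _ ⟨s, ⟨⟨hmax, -⟩, F, hF, hcut⟩, rfl⟩ μ hμ
    have hF' := hF.isMinUnstable hmax
    exact (hlim s μ hμ).hasNontrivialSupport hF' fun hb =>
      (PCSeq.cut_ne_top_iff hF'.not_stable).2 hb hcut
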